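/- A *quantum dichotomy* $(\rho,\sigma)$ is a pair of density matrices on some $\mathbb C^n$ with $\mathrm{supp}(\rho)\subseteq\mathrm{supp}(\sigma)$. A *classical dichotomy* $(p,q)$ is a pair of probability vectors on a finite set with $p\ll q$, or, more generally, a pair of probability densities $p\ll q$ in $L^1(X,\mu)$ for a $\sigma$-finite measure space $(X,\mu)$. All real powers of positive semidefinite matrices and of nonnegative numbers are taken on the support (so $0^\alpha=0$ for all real $\alpha$, and negative powers are pseudo-inverses). For $\alpha\ge 0$, $\alpha\neq1$, put $$D_\alpha(p,q)=\tfrac1{\alpha-1}\log\sum_i p_i^\alpha q_i^{1-\alpha},\qquad D_\alpha^{\mathrm{Petz}}(\rho,\sigma)=\tfrac1{\alpha-1}\log\mathrm{tr}[\rho^\alpha\sigma^{1-\alpha}],\qquad D_\alpha^{\max}(\rho,\sigma)=\tfrac1{\alpha-1}\log\mathrm{tr}\big[\sigma(\sigma^{-1/2}\rho\,\sigma^{-1/2})^\alpha\big],$$ and for $\alpha=1$ put $D_1(p,q)=\sum_i p_i\log(p_i/q_i)$, $D_1^{\mathrm{Petz}}(\rho,\sigma)=\mathrm{tr}[\rho(\log\rho-\log\sigma)]$,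 $D_1^{\max}(\rho,\sigma)=\mathrm{tr}[\rho\log(\rho^{1/2}\sigma^{-1}\rho^{1/2})]$ (logarithms on the support). Two dichotomies are *interconvertible* by a class of maps if there are linear maps $T,R$ of that class with $T(\rho_1)=\rho_2$, $T(\sigma_1)=\sigma_2$, $R(\rho_2)=\rho_1$, $R(\sigma_2)=\sigma_1$. The two classes considered are positive trace-preserving maps and completely positive trace-preserving maps. On $L^1(X,\mu)$ the trace is the integral. A family $\mathbb D_\alpha$ is *sufficient* on $\Lambda\subseteq[0,\infty)$, for a given class of maps, if for all quantum dichotomies $(\rho_1,\sigma_1)$, $(\rho_2,\sigma_2)$ (of possibly different dimensions) and every open interval $(a,b)\subseteq\Lambda$, $a<b$, on which both divergences are finite, the dichotomies are interconvertible if and only if $\mathbb D_\alpha(\rho_1,\sigma_1)=\mathbb D_\alpha(\rho_2,\sigma_2)$ for all $\alpha\in(a,b)$. **Corollary.** 1. Let $\Lambda\subseteq[0,\infty)$ contain a nonempty open interval. Neither $D^{\mathrm{Petz}}_\alpha$ nor $D^{\max}_\alpha$ is sufficient on $\Lambda$, neither for positive trace-preserving maps nor for completely positive trace-preserving maps. 2.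 More precisely, let $\mathbb D_\alpha$ be either family. For every non-commuting quantum dichotomy $(\rho,\sigma)$ there is a classical dichotomy $(p,q)$ on a finite set such that $\mathbb D_\alpha(\rho,\sigma)=D_\alpha(p,q)=\mathbb D_\alpha(\mathrm{diag}(p),\mathrm{diag}(q))$ is finite for all $\alpha\ge0$, while $(\rho,\sigma)$ and $(\mathrm{diag}(p),\mathrm{diag}(q))$ are not interconvertible by positive trace-preserving maps. 3. Both families are classically simulated. Let $(\rho,\sigma)$ be a quantum dichotomy, and let $\rho=\sum_i p_i|u_i\rangle\langle u_i|$, $\sigma=\sum_j q_j|v_j\rangle\langle v_j|$ and $\sigma^{-1/2}\rho\,\sigma^{-1/2}=\sum_i t_i|w_i\rangle\langle w_i|$ be spectral decompositions in orthonormal eigenbases. Then the Nussbaum–Szkoła distributions $P_{ij}=p_i|\langle u_i,v_j\rangle|^2$, $Q_{ij}=q_j|\langle u_i,v_j\rangle|^2$ form a classical dichotomy with $D_\alpha^{\mathrm{Petz}}(\rho,\sigma)=D_\alpha(P,Q)$ for all $\alpha\ge0$, and the vectors $\tilde q_i=\langle w_i,\sigma w_i\rangle$, $\tilde p_i=t_i\tilde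 q_i$ form a classical dichotomy with $D^{\max}_\alpha(\rho,\sigma)=D_\alpha(\tilde p,\tilde q)$ for all $\alpha\ge0$. 4. A non-commuting quantum dichotomy is not interconvertible by positive trace-preserving maps with any commuting quantum dichotomy, nor with any classical dichotomy in $L^1(X,\mu)$, $(X,\mu)$ a $\sigma$-finite measure space. -/

import Mathlib

open MeasureTheory
open scoped ComplexOrder Matrix

noncomputable section

namespace QDichotomy

variable {n m ι : Type*} [Fintype n] [DecidableEq n] [Fintype m] [DecidableEq m] [Fintype ι]

/-- A density matrix. -/
def IsDensity (ρ : Matrix n n ℂ) : Prop :=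
  ρ.PosSemidef ∧ ρ.trace = 1

/-- A quantum dichotomy: two density matrices with `supp ρ ⊆ supp σ`
(the support of a Hermitian matrix is its range). -/
structure IsDichotomy (ρ σ : Matrix n n ℂ) : Prop where
  left : IsDensity ρ
  right : IsDensity σ
  supp_le : LinearMap.range ρ.mulVecLin ≤ LinearMap.range σ.mulVecLin

/-- A classical dichotomy on a finite set: two probability vectors with `p ≪ q`. -/
structure IsClassicalDichotomy (p q : ι → ℝ) : Prop where
  left_nonneg : ∀ i, 0 ≤ p i
  right_nonneg : ∀ i, 0 ≤ q i
  left_sum : ∑ i, p i = 1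
  right_sum : ∑ i, q i = 1
  abs_cont : ∀ i, q i = 0 → p i = 0

/-! ### Rényi divergences -/

/-- Powers on the support: `0 ^ α = 0` for every real `α`, so that negative powers are
pseudo-inverses and the zeroth power is the support projection. -/
def rpowSupp (α x : ℝ) : ℝ := if x = 0 then 0 else x ^ α

/-- The power `A ^ α` of a positive semidefinite matrix, taken on its support. -/
def matPow (A : Matrix n n ℂ) (α : ℝ) : Matrix n n ℂ := cfc (rpowSupp α) A

/-- The logarithm of a positive semidefinite matrix on its support (and zero on its kernel). -/
def matLog (A : Matrix n n ℂ) : Matrix n n ℂ := cfc Real.log A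

/-- `(α - 1)⁻¹ log Q`, with values in the extended reals and `log 0 = -∞`. -/
def renyiOf (α Q : ℝ) : EReal :=
  (((α - 1)⁻¹ : ℝ) : EReal) * ENNReal.log (ENNReal.ofReal Q)

/-- The classical Rényi divergence `D_α(p, q)`; at `α = 1` it is the relative entropy. -/
def classicalRenyi (p q : ι → ℝ) (α : ℝ) : EReal :=
  if α = 1 then ((∑ i, p i * Real.log (p i / q i) : ℝ) : EReal)
  else renyiOf α (∑ i, rpowSupp α (p i) * rpowSupp (1 - α) (q i))

/-- The Petz quantum Rényi divergence, `(α - 1)⁻¹ log tr (ρ ^ α σ ^ (1 - α))`; at `α = 1` it is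
the quantum relative entropy `tr (ρ (log ρ - log σ))`. -/
def petzRenyi (ρ σ : Matrix n n ℂ) (α : ℝ) : EReal :=
  if α = 1 then (((ρ * (matLog ρ - matLog σ)).trace.re : ℝ) : EReal)
  else renyiOf α (matPow ρ α * matPow σ (1 - α)).trace.re

/-- The operator `σ ^ (-1/2) ρ σ ^ (-1/2)`. -/
def relOp (ρ σ : Matrix n n ℂ) : Matrix n n ℂ :=
  matPow σ (-1 / 2) * ρ * matPow σ (-1 / 2)

/-- The maximal quantum Rényi divergence,
`(α - 1)⁻¹ log tr (σ (σ ^ (-1/2) ρ σ ^ (-1/2)) ^ α)`; at `α = 1` it is the Belavkin-Staszewski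
relative entropy `tr (ρ log (ρ ^ (1/2) σ⁻¹ ρ ^ (1/2)))`. -/
def maxRenyi (ρ σ : Matrix n n ℂ) (α : ℝ) : EReal :=
  if α = 1 then
    (((ρ * matLog (matPow ρ (1 / 2) * matPow σ (-1) * matPow ρ (1 / 2))).trace.re : ℝ) : EReal)
  else renyiOf α (σ * matPow (relOp ρ σ) α).trace.re

/-! ### The simulating classical distributions -/

/-- `|⟨u_i, v_j⟩|²` for orthonormal eigenbases `u` of `ρ` and `v` of `σ`. -/
def overlap {ρ σ : Matrix n n ℂ} (hρ : ρ.IsHermitian) (hσ : σ.IsHermitian) (x : n × n) : ℝ :=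
  ‖inner ℂ (hρ.eigenvectorBasis x.1) (hσ.eigenvectorBasis x.2)‖ ^ 2

/-- First Nussbaum-Szkoła distribution, `P (i, j) = p_i |⟨u_i, v_j⟩|²`. -/
def nsLeft {ρ σ : Matrix n n ℂ} (hρ : ρ.IsHermitian) (hσ : σ.IsHermitian) (x : n × n) : ℝ :=
  hρ.eigenvalues x.1 * overlap hρ hσ x

/-- Second Nussbaum-Szkoła distribution, `Q (i, j) = q_j |⟨u_i, v_j⟩|²`. -/
def nsRight {ρ σ : Matrix n n ℂ} (hρ : ρ.IsHermitian) (hσ : σ.IsHermitian) (x : n × n) : ℝ :=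
  hσ.eigenvalues x.2 * overlap hρ hσ x

theorem matPow_isHermitian (A : Matrix n n ℂ) (α : ℝ) : (matPow A α).IsHermitian :=
  cfc_predicate (p := IsSelfAdjoint) (rpowSupp α) A

theorem relOp_isHermitian {ρ : Matrix n n ℂ} (hρ : ρ.IsHermitian) (σ : Matrix n n ℂ) :
    (relOp ρ σ).IsHermitian := by
  have h := Matrix.isHermitian_conjTranspose_mul_mul (matPow σ (-1 / 2)) hρ
  rwa [(matPow_isHermitian σ (-1 / 2)).eq] at h

/-- The spectral weights `⟨w_i, σ w_i⟩` of `σ`, for an orthonormal eigenbasis `w` of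
`T = σ ^ (-1/2) ρ σ ^ (-1/2)`. -/
def spectralRight {ρ : Matrix n n ℂ} (hρ : ρ.IsHermitian) (σ : Matrix n n ℂ) (i : n) : ℝ :=
  (star ((relOp_isHermitian hρ σ).eigenvectorBasis i).ofLp ⬝ᵥ
    (σ *ᵥ ((relOp_isHermitian hρ σ).eigenvectorBasis i).ofLp)).re

/-- The weights `t_i ⟨w_i, σ w_i⟩`, where `t_i` are the eigenvalues of
`T = σ ^ (-1/2) ρ σ ^ (-1/2)`. -/
def spectralLeft {ρ : Matrix n n ℂ} (hρ : ρ.IsHermitian) (σ : Matrix n n ℂ) (i : n) : ℝ :=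
  (relOp_isHermitian hρ σ).eigenvalues i * spectralRight hρ σ i

/-! ### Interconvertibility -/

/-- A positive linear map. -/
def IsPositiveMap (T : Matrix n n ℂ →ₗ[ℂ] Matrix m m ℂ) : Prop :=
  ∀ A, A.PosSemidef → (T A).PosSemidef

/-- A completely positive linear map: `T ⊗ id_k` is positive for all `k`. -/
def IsCPMap (T : Matrix n n ℂ →ₗ[ℂ] Matrix m m ℂ) : Prop :=
  ∀ (k : ℕ) (A : Matrix (n × Fin k) (n × Fin k) ℂ), A.PosSemidef →
    (Matrix.of fun x y : m × Fin k =>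
      T (Matrix.of fun a b : n => A (a, x.2) (b, y.2)) x.1 y.1).PosSemidef

def IsTracePreserving (T : Matrix n n ℂ →ₗ[ℂ] Matrix m m ℂ) : Prop :=
  ∀ A, (T A).trace = A.trace

/-- Interconvertibility by positive trace-preserving maps. -/
def InterconvertibleP (ρ₁ σ₁ : Matrix n n ℂ) (ρ₂ σ₂ : Matrix m m ℂ) : Prop :=
  ∃ (T : Matrix n n ℂ →ₗ[ℂ] Matrix m m ℂ) (R : Matrix m m ℂ →ₗ[ℂ] Matrix n n ℂ),
    IsPositiveMap T ∧ IsTracePreserving T ∧ IsPositiveMap R ∧ IsTracePreserving R ∧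
    T ρ₁ = ρ₂ ∧ T σ₁ = σ₂ ∧ R ρ₂ = ρ₁ ∧ R σ₂ = σ₁

/-- Interconvertibility by quantum channels (completely positive trace-preserving maps). -/
def InterconvertibleCP (ρ₁ σ₁ : Matrix n n ℂ) (ρ₂ σ₂ : Matrix m m ℂ) : Prop :=
  ∃ (T : Matrix n n ℂ →ₗ[ℂ] Matrix m m ℂ) (R : Matrix m m ℂ →ₗ[ℂ] Matrix n n ℂ),
    IsCPMap T ∧ IsTracePreserving T ∧ IsCPMap R ∧ IsTracePreserving R ∧
    T ρ₁ = ρ₂ ∧ T σ₁ = σ₂ ∧ R ρ₂ = ρ₁ ∧ R σ₂ = σ₁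

section Classical

variable {X : Type*} [MeasurableSpace X] {μ : Measure X}

/-- Two probability densities with respect to `μ`, the first one absolutely continuous with respect
to the second one. -/
structure IsL1Dichotomy (p q : X →₁[μ] ℂ) : Prop where
  left_nonneg : ∀ᵐ x ∂μ, 0 ≤ p x
  right_nonneg : ∀ᵐ x ∂μ, 0 ≤ q x
  left_integral : ∫ x, p x ∂μ = 1
  right_integral : ∫ x, q x ∂μ = 1
  abs_cont : ∀ᵐ x ∂μ, q x = 0 → p x = 0

/-- Interconvertibility of a quantum dichotomy with a dichotomy on the classical system `(X, μ)` by
positive trace-preserving maps; the trace on `L¹(X, μ)` is the integral. -/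
def InterconvertibleClassical (ρ σ : Matrix n n ℂ) (p q : X →₁[μ] ℂ) : Prop :=
  ∃ (T : Matrix n n ℂ →ₗ[ℂ] (X →₁[μ] ℂ)) (R : (X →₁[μ] ℂ) →ₗ[ℂ] Matrix n n ℂ),
    (∀ A, A.PosSemidef → ∀ᵐ x ∂μ, 0 ≤ T A x) ∧ (∀ A, ∫ x, T A x ∂μ = A.trace) ∧
    (∀ f : X →₁[μ] ℂ, (∀ᵐ x ∂μ, 0 ≤ f x) → (R f).PosSemidef) ∧
    (∀ f : X →₁[μ] ℂ, (R f).trace = ∫ x, f x ∂μ) ∧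
    T ρ = p ∧ T σ = q ∧ R p = ρ ∧ R q = σ

end Classical

/-- The family `D` is sufficient on the parameter set `Λ` for the notion `Conv` of
interconvertibility: for any two dichotomies whose divergences are finite on an open interval
contained in `Λ`, interconvertibility is equivalent to equality of the divergences on it. -/
def IsSufficient
    (Conv : ∀ n m : ℕ, Matrix (Fin n) (Fin n) ℂ → Matrix (Fin n) (Fin n) ℂ →
      Matrix (Fin m) (Fin m) ℂ → Matrix (Fin m) (Fin m) ℂ → Prop)
    (D : ∀ n : ℕ, Matrix (Fin n) (Fin n) ℂ → Matrix (Fin n) (Fin n) ℂ → ℝ → EReal)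
    (Λ : Set ℝ) : Prop :=
  ∀ (n m : ℕ) (ρ₁ σ₁ : Matrix (Fin n) (Fin n) ℂ) (ρ₂ σ₂ : Matrix (Fin m) (Fin m) ℂ),
    IsDichotomy ρ₁ σ₁ → IsDichotomy ρ₂ σ₂ →
    ∀ a b : ℝ, a < b → Set.Ioo a b ⊆ Λ →
    (∀ α ∈ Set.Ioo a b, (D n ρ₁ σ₁ α ≠ ⊤ ∧ D n ρ₁ σ₁ α ≠ ⊥) ∧
      (D m ρ₂ σ₂ α ≠ ⊤ ∧ D m ρ₂ σ₂ α ≠ ⊥)) →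
    (Conv n m ρ₁ σ₁ ρ₂ σ₂ ↔ ∀ α ∈ Set.Ioo a b, D n ρ₁ σ₁ α = D m ρ₂ σ₂ α)

/-- For every non-commuting dichotomy there is a diagonal one, on some finite-dimensional system,
that has the same finite divergences at every `α ≥ 0` but is not interconvertible with it by
positive trace-preserving maps. -/
def FailsAtEveryNoncommuting
    (D : ∀ n : ℕ, Matrix (Fin n) (Fin n) ℂ → Matrix (Fin n) (Fin n) ℂ → ℝ → EReal) : Prop :=
  ∀ (n : ℕ) (ρ σ : Matrix (Fin n) (Fin n) ℂ), IsDichotomy ρ σ → ¬ Commute ρ σ →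
    ∃ (m : ℕ) (p q : Fin m → ℝ), IsClassicalDichotomy p q ∧
      (∀ α : ℝ, 0 ≤ α →
        D n ρ σ α = classicalRenyi p q α ∧
        D m (Matrix.diagonal fun i => (p i : ℂ)) (Matrix.diagonal fun i => (q i : ℂ)) α
          = classicalRenyi p q α ∧
        classicalRenyi p q α ≠ ⊤ ∧ classicalRenyi p q α ≠ ⊥) ∧
      ¬ InterconvertibleP ρ σ
          (Matrix.diagonal fun i => (p i : ℂ)) (Matrix.diagonal fun i => (q i : ℂ))

end QDichotomy

end

open QDichotomy

/-! Rigidity comes from squeezing a classical `χ²`-quantity between two quantum ones. Let `L` solve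
`σ L + L σ = 2 ρ`. Measuring can only lower `tr (L σ L)`, the symmetric logarithmic version, while
preparing a state from classical data cannot exceed the classical value in the maximal version, the
supremum over `X` of `2 Re tr (X ρ) - tr (Xᴴ σ X)`. A round trip through a classical system
therefore bounds the supremum by `tr (L σ L)` (`two_trace_sub_trace_le`). This value is attained at
`X = L`, so `L` is a maximiser; the first variation along the adjoint of `σ L - L σ` forces `L` to
commute with `σ`, whence `ρ = L σ` commutes with `σ` (`commute_of_forall_two_trace_sub_trace_le`).
Only positivity of the maps enters. For a commuting matrix pair the classical data are finite; in
`L¹` the density ratio is bounded and is rounded down to finitely many values, with an error that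
tends to zero. Both divergence families see only classical data: the Petz family pairs the spectra
of `ρ` and `σ` through the overlaps of their eigenvectors, the maximal family weights the spectrum
of `relOp ρ σ` by `σ`. A non-commuting dichotomy thus shares all its divergences with a diagonal
one, into which it cannot be converted and back; one explicit qubit pair then refutes sufficiency.
-/

namespace QDichotomy

/-! ### Functional calculus of Hermitian matrices in eigenbases. -/

section LinearAlgebra

variable {n : Type*} [Fintype n] [DecidableEq n]

theorem continuousOn_spectrum (f : ℝ → ℝ) (A : Matrix n n ℂ) : ContinuousOn f (spectrum ℝ A) :=
  (Matrix.finite_real_spectrum (𝕜 := ℂ) (A := A)).continuousOn f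

/-- The unitary matrix of an orthonormal eigenbasis of a Hermitian matrix. -/
noncomputable abbrev eigU {A : Matrix n n ℂ} (hA : A.IsHermitian) : Matrix n n ℂ :=
  hA.eigenvectorUnitary

theorem eigU_star_mul {A : Matrix n n ℂ} (hA : A.IsHermitian) : (eigU hA)ᴴ * eigU hA = 1 :=
  Unitary.coe_star_mul_self hA.eigenvectorUnitary

theorem eigU_mul_star {A : Matrix n n ℂ} (hA : A.IsHermitian) : eigU hA * (eigU hA)ᴴ = 1 :=
  Unitary.coe_mul_star_self hA.eigenvectorUnitary

theorem cfc_eq_mul {A : Matrix n n ℂ} (hA : A.IsHermitian) (f : ℝ → ℝ) :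
    cfc f A = eigU hA * Matrix.diagonal (fun i => ((f (hA.eigenvalues i) : ℝ) : ℂ)) *
      (eigU hA)ᴴ := by
  rw [hA.cfc_eq, Matrix.IsHermitian.cfc, Unitary.conjStarAlgAut_apply]
  rfl

theorem eq_eigU_mul {A : Matrix n n ℂ} (hA : A.IsHermitian) :
    A = eigU hA * Matrix.diagonal (fun i => (hA.eigenvalues i : ℂ)) * (eigU hA)ᴴ := by
  conv_lhs => rw [hA.spectral_theorem, Unitary.conjStarAlgAut_apply]
  rfl

/-- In eigenbasis coordinates `v` lives only on indices whose eigenvalue is `l`. The case `v = 0` is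
allowed, which spares case distinctions later. -/
theorem cfc_mulVec_of_mulVec {A : Matrix n n ℂ} (hA : A.IsHermitian) (f : ℝ → ℝ)
    {v : n → ℂ} {l : ℝ} (hv : A *ᵥ v = (l : ℂ) • v) : cfc f A *ᵥ v = (f l : ℂ) • v := by
  set U := eigU hA
  have h1 : Matrix.diagonal (fun i => (hA.eigenvalues i : ℂ)) *ᵥ (Uᴴ *ᵥ v) =
      (l : ℂ) • (Uᴴ *ᵥ v) := by
    have := congrArg (fun w => Uᴴ *ᵥ w) hv
    rw [eq_eigU_mul hA] at this
    simp only [Matrix.mulVec_mulVec, Matrix.mulVec_smul] at this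
    rw [← this, ← Matrix.mul_assoc, ← Matrix.mul_assoc, eigU_star_mul hA, Matrix.one_mul,
      Matrix.mulVec_mulVec]
  have h2 : Matrix.diagonal (fun i => ((f (hA.eigenvalues i) : ℝ) : ℂ)) *ᵥ (Uᴴ *ᵥ v) =
      (f l : ℂ) • (Uᴴ *ᵥ v) := by
    ext i
    have := congrFun h1 i
    simp only [Matrix.mulVec_diagonal, Pi.smul_apply, smul_eq_mul] at this ⊢
    rcases mul_eq_mul_right_iff.1 this with h | h
    · rw [Complex.ofReal_inj.1 h]
    · simp [h]
  rw [cfc_eq_mul hA, ← Matrix.mulVec_mulVec, ← Matrix.mulVec_mulVec, h2, Matrix.mulVec_smul,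
    Matrix.mulVec_mulVec, eigU_mul_star hA, Matrix.one_mulVec]

theorem cfc_diagonal (f : ℝ → ℝ) (d : n → ℝ) :
    cfc f (Matrix.diagonal fun i => (d i : ℂ)) = Matrix.diagonal fun i => ((f (d i) : ℝ) : ℂ) := by
  have hd : (Matrix.diagonal fun i => (d i : ℂ)).IsHermitian := by
    rw [Matrix.isHermitian_diagonal_iff]
    intro i
    exact Complex.conj_ofReal _
  refine Matrix.ext_of_mulVec_single fun j => ?_
  rw [cfc_mulVec_of_mulVec hd f (l := d j)]
  · ext i
    by_cases h : i = j
    · subst h; simp [Matrix.mulVec_diagonal]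
    · simp [Matrix.mulVec_diagonal, h]
  · ext i
    by_cases h : i = j
    · subst h; simp [Matrix.mulVec_diagonal]
    · simp [Matrix.mulVec_diagonal, h]

/-- Functional calculus intertwines `Bᴴ B` and `B Bᴴ`. -/
theorem mul_cfc_conjTranspose_mul_self (B : Matrix n n ℂ) (f : ℝ → ℝ) :
    B * cfc f (Bᴴ * B) = cfc f (B * Bᴴ) * B := by
  have h1 : (Bᴴ * B).IsHermitian := Matrix.isHermitian_conjTranspose_mul_self B
  have h2 : (B * Bᴴ).IsHermitian := Matrix.isHermitian_mul_conjTranspose_self B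
  -- It suffices to test on an eigenbasis of `Bᴴ B`: if `w` has eigenvalue `l`, then `B w` is zero
  -- or an eigenvector of `B Bᴴ` for the same `l`.
  have key : B * cfc f (Bᴴ * B) * eigU h1 = cfc f (B * Bᴴ) * B * eigU h1 := by
    refine Matrix.ext_of_mulVec_single fun j => ?_
    set w : n → ℂ := (h1.eigenvectorBasis j).ofLp
    have he : eigU h1 *ᵥ Pi.single j 1 = w := h1.eigenvectorUnitary_mulVec j
    have hw : (Bᴴ * B) *ᵥ w = (h1.eigenvalues j : ℂ) • w := by
      have := h1.mulVec_eigenvectorBasis j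
      ext i
      simpa using congrFun this i
    have hBw : (B * Bᴴ) *ᵥ (B *ᵥ w) = (h1.eigenvalues j : ℂ) • (B *ᵥ w) := by
      rw [← Matrix.mulVec_smul, ← hw]
      simp [Matrix.mulVec_mulVec, Matrix.mul_assoc]
    simp only [← Matrix.mulVec_mulVec, he]
    rw [cfc_mulVec_of_mulVec h1 f hw, cfc_mulVec_of_mulVec h2 f hBw, Matrix.mulVec_smul]
  have := congrArg (· * (eigU h1)ᴴ) key
  simpa only [Matrix.mul_assoc, eigU_mul_star, Matrix.mul_one] using this

theorem trace_mul_cfc {A : Matrix n n ℂ} (hA : A.IsHermitian) (f : ℝ → ℝ) (B : Matrix n n ℂ) :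
    (B * cfc f A).trace = ∑ i, (f (hA.eigenvalues i) : ℂ) *
      (star (hA.eigenvectorBasis i).ofLp ⬝ᵥ (B *ᵥ (hA.eigenvectorBasis i).ofLp)) := by
  rw [cfc_eq_mul hA, ← Matrix.mul_assoc, Matrix.trace_mul_comm, ← Matrix.mul_assoc,
    ← Matrix.mul_assoc, Matrix.trace]
  refine Finset.sum_congr rfl fun i _ => ?_
  rw [Matrix.diag_apply, Matrix.mul_diagonal, mul_comm, Matrix.mul_assoc]
  congr 1

theorem trace_mul_nonneg {A B : Matrix n n ℂ} (hA : A.PosSemidef) (hB : B.PosSemidef) :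
    0 ≤ (A * B).trace := by
  obtain ⟨C, rfl⟩ : ∃ C : Matrix n n ℂ, A = Cᴴ * C := by
    open MatrixOrder in
    exact CStarAlgebra.nonneg_iff_eq_star_mul_self.1 hA.nonneg
  rw [Matrix.mul_assoc, Matrix.trace_mul_comm]
  exact (hB.mul_mul_conjTranspose_same C).trace_nonneg

theorem exists_smul_one_sub_posSemidef {Y : Matrix n n ℂ} (hY : Y.IsHermitian) :
    ∃ M : ℝ, 0 ≤ M ∧ ((M : ℂ) • 1 - Y).PosSemidef := by
  -- The sum of absolute values is a crude bound for every eigenvalue; unlike a maximum it also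
  -- makes sense in dimension zero.
  refine ⟨∑ i, |hY.eigenvalues i|, Finset.sum_nonneg fun _ _ => abs_nonneg _, ?_⟩
  set M := ∑ i, |hY.eigenvalues i|
  have : ((M : ℂ) • 1 - Y) = eigU hY * Matrix.diagonal (fun i => ((M - hY.eigenvalues i : ℝ) : ℂ))
      * (eigU hY)ᴴ := by
    have hd : Matrix.diagonal (fun i => ((M - hY.eigenvalues i : ℝ) : ℂ)) =
        (M : ℂ) • 1 - Matrix.diagonal (fun i => (hY.eigenvalues i : ℂ)) := by
      ext i j
      by_cases h : i = j
      · subst h; simp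
      · simp [h]
    rw [hd, Matrix.mul_sub, Matrix.sub_mul, ← eq_eigU_mul hY, Matrix.mul_smul, Matrix.mul_one,
      Matrix.smul_mul, eigU_mul_star]
  rw [this]
  refine Matrix.PosSemidef.mul_mul_conjTranspose_same (Matrix.PosSemidef.diagonal fun i => ?_) _
  rw [Pi.zero_apply, Complex.zero_le_real, sub_nonneg]
  exact (le_abs_self _).trans
    (Finset.single_le_sum (f := fun i => |hY.eigenvalues i|) (fun _ _ => abs_nonneg _)
      (Finset.mem_univ i))

end LinearAlgebra

/-! ### Consequences of the support condition. -/

section Dichotomy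

variable {n : Type*} [Fintype n] [DecidableEq n] {ρ σ : Matrix n n ℂ}

theorem IsDichotomy.exists_eq_mul (h : IsDichotomy ρ σ) : ∃ W : Matrix n n ℂ, ρ = σ * W := by
  have : ∀ j, ∃ w, σ *ᵥ w = ρ *ᵥ Pi.single j 1 := fun j => h.supp_le ⟨Pi.single j 1, rfl⟩
  choose w hw using this
  refine ⟨Matrix.of fun i j => w j i, Matrix.ext_of_mulVec_single fun j => ?_⟩
  rw [← Matrix.mulVec_mulVec, ← hw j]
  congr 1
  ext i
  simp

theorem isDichotomy_of_eq_mul {n : Type*} [Fintype n] {ρ σ : Matrix n n ℂ} (hρ : IsDensity ρ)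
    (hσ : IsDensity σ) {W : Matrix n n ℂ}
    (h : ρ = σ * W) : IsDichotomy ρ σ := by
  refine ⟨hρ, hσ, ?_⟩
  rintro _ ⟨v, rfl⟩
  refine ⟨W *ᵥ v, ?_⟩
  simp [h, Matrix.mulVec_mulVec]

theorem matPow_mul_matPow (hσ : σ.PosSemidef) {a b c : ℝ} (h : a + b = c) :
    matPow σ a * matPow σ b = matPow σ c := by
  rw [matPow, matPow, matPow, ← cfc_mul _ _ _ (continuousOn_spectrum _ _)
    (continuousOn_spectrum _ _)]
  refine cfc_congr fun x hx => ?_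
  rw [hσ.1.spectrum_real_eq_range_eigenvalues] at hx
  obtain ⟨i, rfl⟩ := hx
  have := hσ.eigenvalues_nonneg i
  simp only [rpowSupp]
  split_ifs with h0
  · simp
  · rw [← h, Real.rpow_add (lt_of_le_of_ne this (Ne.symm h0))]

theorem matPow_one (hσ : σ.PosSemidef) : matPow σ 1 = σ := by
  conv_rhs => rw [← cfc_id' ℝ σ (ha := hσ.1)]
  refine cfc_congr fun x _ => ?_
  simp only [rpowSupp]
  split_ifs with h0
  · exact h0.symm
  · simp

theorem matPow_zero_mul (hσ : σ.PosSemidef) : matPow σ 0 * σ = σ := by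
  have h := matPow_mul_matPow hσ (zero_add 1)
  rwa [matPow_one hσ] at h

theorem IsDichotomy.matPow_zero_mul (h : IsDichotomy ρ σ) : matPow σ 0 * ρ = ρ := by
  obtain ⟨W, hW⟩ := h.exists_eq_mul
  rw [hW, ← Matrix.mul_assoc, QDichotomy.matPow_zero_mul h.right.1]

theorem IsDichotomy.mul_matPow_zero (h : IsDichotomy ρ σ) : ρ * matPow σ 0 = ρ := by
  have := congrArg Matrix.conjTranspose h.matPow_zero_mul
  rwa [Matrix.conjTranspose_mul, h.left.1.1.eq, (matPow_isHermitian σ 0).eq] at this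

/-- The opposite powers of `σ` collapse to its support projection, which fixes `ρ` from both sides.
-/
theorem IsDichotomy.sqrt_mul_relOp_mul_sqrt (h : IsDichotomy ρ σ) :
    matPow σ (1 / 2) * relOp ρ σ * matPow σ (1 / 2) = ρ := by
  have e1 : matPow σ (1 / 2) * matPow σ (-1 / 2) = matPow σ 0 :=
    matPow_mul_matPow h.right.1 (by norm_num)
  have e2 : matPow σ (-1 / 2) * matPow σ (1 / 2) = matPow σ 0 :=
    matPow_mul_matPow h.right.1 (by norm_num)
  calc _ = (matPow σ (1 / 2) * matPow σ (-1 / 2)) * ρ *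
          (matPow σ (-1 / 2) * matPow σ (1 / 2)) := by
        simp only [relOp, Matrix.mul_assoc]
    _ = ρ := by rw [e1, e2, h.matPow_zero_mul, h.mul_matPow_zero]

theorem sqrt_mul_sqrt (hσ : σ.PosSemidef) : matPow σ (1 / 2) * matPow σ (1 / 2) = σ := by
  rw [matPow_mul_matPow hσ (c := 1) (by norm_num), matPow_one hσ]

theorem relOp_posSemidef (hρ : ρ.PosSemidef) (σ : Matrix n n ℂ) : (relOp ρ σ).PosSemidef := by
  have := hρ.mul_mul_conjTranspose_same (matPow σ (-1 / 2))
  rwa [(matPow_isHermitian σ _).eq] at this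

/-- A bound `relOp ρ σ ≤ C`, conjugated by the square root of `σ`. It later bounds the density ratio
of an `L¹` dichotomy. -/
theorem IsDichotomy.exists_le_smul (h : IsDichotomy ρ σ) :
    ∃ C : ℝ, 0 ≤ C ∧ ((C : ℂ) • σ - ρ).PosSemidef := by
  obtain ⟨C, hC, hp⟩ := exists_smul_one_sub_posSemidef (relOp_isHermitian h.left.1.1 σ)
  refine ⟨C, hC, ?_⟩
  have := hp.mul_mul_conjTranspose_same (matPow σ (1 / 2))
  rwa [(matPow_isHermitian σ _).eq, Matrix.mul_sub, Matrix.sub_mul, h.sqrt_mul_relOp_mul_sqrt,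
    Matrix.mul_smul, Matrix.mul_one, Matrix.smul_mul, sqrt_mul_sqrt h.right.1] at this

/-- The symmetric logarithmic derivative equation `σ L + L σ = 2 ρ` has a Hermitian solution. -/
theorem IsDichotomy.exists_sld (h : IsDichotomy ρ σ) :
    ∃ L : Matrix n n ℂ, L.IsHermitian ∧ σ * L + L * σ = (2 : ℂ) • ρ := by
  obtain ⟨W, hW⟩ := h.exists_eq_mul
  have hσ := h.right.1.1
  set U := eigU hσ with hU
  set s := hσ.eigenvalues with hs
  have hs0 : ∀ i, 0 ≤ s i := h.right.1.eigenvalues_nonneg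
  set D := Matrix.diagonal (fun i => (s i : ℂ)) with hD
  have hσD : σ = U * D * Uᴴ := eq_eigU_mul hσ
  have hUU : Uᴴ * U = 1 := eigU_star_mul hσ
  have hUU' : U * Uᴴ = 1 := eigU_mul_star hσ
  set r := Uᴴ * ρ * U with hr
  have hrD : r = D * (Uᴴ * W * U) := by
    calc r = (Uᴴ * U) * D * (Uᴴ * W * U) := by
          rw [hr, hW, hσD]; simp only [Matrix.mul_assoc]
      _ = _ := by rw [hUU, Matrix.one_mul]
  have hrh : r.IsHermitian := Matrix.isHermitian_conjTranspose_mul_mul U h.left.1.1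
  -- In the eigenbasis of `σ` the equation decouples into entries. Where `s i + s j = 0` the
  -- quotient is `0` by convention, which is correct because `ρ = σ W` makes row `i` of `r` vanish
  -- there.
  set K : Matrix n n ℂ := Matrix.of fun i j => 2 * r i j / ((s i : ℂ) + s j) with hK
  have hKh : K.IsHermitian := by
    ext i j
    have := hrh.apply i j
    simp only [hK, Matrix.conjTranspose_apply, Matrix.of_apply]
    rw [← this]
    simp [add_comm]
  have hDK : D * K + K * D = (2 : ℂ) • r := by
    ext i j
    simp only [hD, Matrix.add_apply, Matrix.diagonal_mul, Matrix.mul_diagonal, hK, Matrix.of_apply,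
      Matrix.smul_apply, smul_eq_mul]
    by_cases h0 : s i + s j = 0
    · have hi : s i = 0 := by linarith [hs0 i, hs0 j]
      have : r i j = 0 := by rw [hrD, hD, Matrix.diagonal_mul, hi]; simp
      simp [this]
    · have : (s i : ℂ) + s j ≠ 0 := by exact_mod_cast h0
      field_simp
  refine ⟨U * K * Uᴴ, ?_, ?_⟩
  · simpa using Matrix.isHermitian_conjTranspose_mul_mul Uᴴ hKh
  · calc σ * (U * K * Uᴴ) + U * K * Uᴴ * σ
        = U * D * (Uᴴ * U) * K * Uᴴ + U * K * (Uᴴ * U) * D * Uᴴ := by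
          rw [hσD]; simp only [Matrix.mul_assoc]
      _ = U * (D * K + K * D) * Uᴴ := by
          rw [hUU]; simp only [Matrix.mul_assoc, Matrix.mul_one, Matrix.mul_add,
            Matrix.add_mul]
      _ = (2 : ℂ) • ((U * Uᴴ) * ρ * (U * Uᴴ)) := by
          rw [hDK, hr]; simp only [Matrix.mul_smul, Matrix.smul_mul, Matrix.mul_assoc]
      _ = _ := by rw [hUU', Matrix.one_mul, Matrix.mul_one]

end Dichotomy

/-! ### The `χ²` squeeze and its equality case. -/

section Rigidity

variable {n : Type*} [Fintype n] [DecidableEq n] {ρ σ L : Matrix n n ℂ}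

/-- A measurement `φ` and a preparation `S` bounding the `χ²`-divergence between its symmetric
logarithmic and its maximal version. -/
theorem two_trace_sub_trace_le {K : Type*} (s : Finset K)
    (hσ : σ.PosSemidef) (hL : L.IsHermitian) (hLσ : σ * L + L * σ = (2 : ℂ) • ρ)
    (φ : K → Matrix n n ℂ →ₗ[ℂ] ℂ) (hφ : ∀ k ∈ s, ∀ A, A.PosSemidef → 0 ≤ φ k A)
    (hφtr : ∀ A, ∑ k ∈ s, φ k A = A.trace)
    (S : K → Matrix n n ℂ) (hS : ∀ k ∈ s, (S k).PosSemidef) (hSσ : ∑ k ∈ s, S k = σ)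
    (hStr : ∀ k ∈ s, (S k).trace = φ k σ)
    (c : K → ℝ) (hc : ∀ k ∈ s, 0 ≤ c k) (hcφ : ∀ k ∈ s, c k * (φ k σ).re ≤ (φ k ρ).re)
    (X : Matrix n n ℂ) :
    2 * (X * ∑ k ∈ s, (c k : ℂ) • S k).trace.re - (Xᴴ * σ * X).trace.re ≤
      (L * σ * L).trace.re := by
  -- Measurement side: `φ k` is applied to the positive matrix `(L - c) σ (L - c)ᴴ`. A lower bound
  -- `c k` for the likelihood ratio is enough, so ratios may be rounded down.
  have h1 : ∀ k ∈ s, c k ^ 2 * (φ k σ).re ≤ (φ k (L * σ * L)).re := by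
    intro k hk
    have hp : ((L - (c k : ℂ) • 1) * σ * (L - (c k : ℂ) • 1)ᴴ).PosSemidef :=
      hσ.mul_mul_conjTranspose_same _
    have he : (L - (c k : ℂ) • 1) * σ * (L - (c k : ℂ) • 1)ᴴ =
        L * σ * L - (2 * c k : ℂ) • ρ + (c k ^ 2 : ℂ) • σ := by
      rw [mul_comm (2 : ℂ), mul_smul, ← hLσ]
      simp only [Matrix.conjTranspose_sub, hL.eq, Matrix.conjTranspose_smul,
        Matrix.conjTranspose_one, Complex.star_def, Complex.conj_ofReal, Matrix.sub_mul,
        Matrix.mul_sub, Matrix.smul_mul, Matrix.mul_smul, Matrix.mul_one, Matrix.one_mul, smul_add,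
        smul_sub, smul_smul, pow_two]
      abel
    have h0 := (Complex.nonneg_iff.1 (hφ k hk _ hp)).1
    rw [he] at h0
    have hre : (φ k (L * σ * L - (2 * c k : ℂ) • ρ + (c k ^ 2 : ℂ) • σ)).re =
        (φ k (L * σ * L)).re - 2 * c k * (φ k ρ).re + c k ^ 2 * (φ k σ).re := by
      simp [← Complex.ofReal_pow]
    rw [hre] at h0
    nlinarith [mul_le_mul_of_nonneg_left (hcφ k hk) (hc k hk)]
  -- Preparation side: the same square, now with `Xᴴ - c` around `S k`, under the trace.
  have h2 : ∀ k ∈ s, 2 * (X * ((c k : ℂ) • S k)).trace.re - (Xᴴ * S k * X).trace.re ≤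
      c k ^ 2 * (φ k σ).re := by
    intro k hk
    have hp := (((hS k hk).mul_mul_conjTranspose_same (Xᴴ - (c k : ℂ) • 1)).trace_nonneg)
    have h0 := (Complex.nonneg_iff.1 hp).1
    have he : (Xᴴ - (c k : ℂ) • 1) * S k * (Xᴴ - (c k : ℂ) • 1)ᴴ =
        Xᴴ * S k * X - (c k : ℂ) • (S k * X) - (c k : ℂ) • (S k * X)ᴴ + (c k ^ 2 : ℂ) • S k := by
      simp only [Matrix.conjTranspose_sub, Matrix.conjTranspose_mul, (hS k hk).1.eq,
        Matrix.conjTranspose_smul, Matrix.conjTranspose_conjTranspose,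
        Matrix.conjTranspose_one, Complex.star_def, Complex.conj_ofReal, Matrix.sub_mul,
        Matrix.mul_sub, Matrix.smul_mul, Matrix.mul_smul, Matrix.mul_one, Matrix.one_mul,
        smul_sub, smul_smul, pow_two]
      abel
    rw [he] at h0
    have hre : (Xᴴ * S k * X - (c k : ℂ) • (S k * X) - (c k : ℂ) • (S k * X)ᴴ +
        (c k ^ 2 : ℂ) • S k).trace.re =
        (Xᴴ * S k * X).trace.re - 2 * (c k * (S k * X).trace.re) + c k ^ 2 * (S k).trace.re := by
      rw [Matrix.trace_add, Matrix.trace_sub, Matrix.trace_sub, Matrix.trace_smul,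
        Matrix.trace_smul, Matrix.trace_smul, Matrix.trace_conjTranspose]
      simp [← Complex.ofReal_pow]
      ring
    rw [hre, hStr k hk] at h0
    rw [Matrix.mul_smul, Matrix.trace_smul, Matrix.trace_mul_comm]
    simp only [smul_eq_mul, Complex.re_ofReal_mul]
    linarith
  have h3 := Finset.sum_le_sum fun k hk => (h2 k hk).trans (h1 k hk)
  rw [Finset.sum_sub_distrib, ← Finset.mul_sum, ← Complex.re_sum, ← Complex.re_sum,
    ← Complex.re_sum, hφtr, ← Matrix.trace_sum, ← Matrix.trace_sum, ← Matrix.mul_sum,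
    ← Finset.sum_mul, ← Matrix.mul_sum, hSσ] at h3
  exact h3

theorem commute_of_forall_two_trace_sub_trace_le {n : Type*} [Fintype n] {ρ σ L : Matrix n n ℂ}
    (hσ : σ.IsHermitian) (hL : L.IsHermitian)
    (hLσ : σ * L + L * σ = (2 : ℂ) • ρ)
    (h : ∀ X : Matrix n n ℂ,
      2 * (X * ρ).trace.re - (Xᴴ * σ * X).trace.re ≤ (L * σ * L).trace.re) :
    Commute ρ σ := by
  -- With this direction the first-order term at `X = L` is exactly `tr (Z Zᴴ)`, the squared norm of
  -- the commutator.
  set Z := (σ * L - L * σ)ᴴ with hZ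
  have key : ∀ t : ℝ, t * (Z * Zᴴ).trace.re ≤ t ^ 2 * (Zᴴ * σ * Z).trace.re := by
    intro t
    have h0 := h (L + (t : ℂ) • Z)
    have e1 : 2 * ((L + (t : ℂ) • Z) * ρ).trace.re =
        2 * (L * σ * L).trace.re + t * (Z * (σ * L + L * σ)).trace.re := by
      have : (2 : ℂ) * ((L + (t : ℂ) • Z) * ρ).trace =
          2 * (L * σ * L).trace + t * (Z * (σ * L + L * σ)).trace := by
        rw [← smul_eq_mul, ← Matrix.trace_smul, ← Matrix.mul_smul, ← hLσ, Matrix.add_mul,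
          Matrix.mul_add L, Matrix.trace_add, Matrix.trace_add, Matrix.smul_mul,
          Matrix.trace_smul, smul_eq_mul, ← Matrix.mul_assoc, Matrix.trace_mul_comm L (L * σ)]
        ring
      simpa using congrArg Complex.re this
    have e2 : ((L + (t : ℂ) • Z)ᴴ * σ * (L + (t : ℂ) • Z)).trace.re =
        (L * σ * L).trace.re + 2 * (t * (Z * L * σ).trace.re) + t ^ 2 * (Zᴴ * σ * Z).trace.re := by
      have : (L + (t : ℂ) • Z)ᴴ * σ * (L + (t : ℂ) • Z) =
          L * σ * L + (t : ℂ) • (L * σ * Z) + (t : ℂ) • (L * σ * Z)ᴴ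
            + (t ^ 2 : ℂ) • (Zᴴ * σ * Z) := by
        simp only [Matrix.conjTranspose_add, Matrix.conjTranspose_mul, hL.eq, hσ.eq,
          Matrix.conjTranspose_smul, Complex.star_def, Complex.conj_ofReal, Matrix.add_mul,
          Matrix.mul_add, Matrix.smul_mul, Matrix.mul_smul, smul_add, smul_smul, pow_two,
          Matrix.mul_assoc]
        abel
      rw [this, Matrix.trace_add, Matrix.trace_add, Matrix.trace_add, Matrix.trace_smul,
        Matrix.trace_smul, Matrix.trace_smul, Matrix.trace_conjTranspose,
        Matrix.trace_mul_comm (L * σ) Z, ← Matrix.mul_assoc]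
      simp [← Complex.ofReal_pow]
      ring
    have e3 : (Z * Zᴴ).trace.re =
        (Z * (σ * L + L * σ)).trace.re - 2 * (Z * L * σ).trace.re := by
      have : Z * Zᴴ = Z * (σ * L + L * σ) - (2 : ℂ) • (Z * L * σ) := by
        rw [hZ, Matrix.conjTranspose_conjTranspose, two_smul]
        simp only [Matrix.mul_sub, Matrix.mul_add, Matrix.mul_assoc]
        abel
      rw [this, Matrix.trace_sub, Matrix.trace_smul]
      simp
    rw [e1, e2] at h0
    rw [e3]
    linarith
  set a := (Z * Zᴴ).trace.re
  set b := (Zᴴ * σ * Z).trace.re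
  have ha : a ≤ 0 := by
    by_contra! ha
    -- This `t` satisfies `t b ≤ a / 2`, against `a ≤ t b`; the `+ 1` covers `b = 0`.
    have hpos : 0 < a / (2 * (|b| + 1)) := by positivity
    have h1 := key (a / (2 * (|b| + 1)))
    rw [pow_two, mul_assoc] at h1
    have h2 := le_of_mul_le_mul_left h1 hpos
    have h3 : a / (2 * (|b| + 1)) * b ≤ a / (2 * (|b| + 1)) * (|b| + 1) :=
      mul_le_mul_of_nonneg_left (by linarith [le_abs_self b]) hpos.le
    have h4 : a / (2 * (|b| + 1)) * (|b| + 1) = a / 2 := by field_simp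
    linarith
  have hps := Matrix.posSemidef_self_mul_conjTranspose Z
  have htr : (Z * Zᴴ).trace = 0 := by
    have h0 := hps.trace_nonneg
    rw [Complex.nonneg_iff] at h0
    exact Complex.ext (le_antisymm ha h0.1) h0.2.symm
  have hZ0 : Z = 0 := Matrix.trace_mul_conjTranspose_self_eq_zero_iff.1 htr
  have hc : σ * L = L * σ := by
    have := congrArg Matrix.conjTranspose hZ0
    rw [hZ, Matrix.conjTranspose_conjTranspose, Matrix.conjTranspose_zero] at this
    exact sub_eq_zero.1 this
  have hρ : ρ = L * σ := by
    have h2 : (2 : ℂ) • ρ = (2 : ℂ) • (L * σ) := by rw [← hLσ, hc, two_smul]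
    exact smul_right_injective _ (two_ne_zero' ℂ) h2
  rw [hρ]
  change L * σ * σ = σ * (L * σ)
  rw [← Matrix.mul_assoc, hc]

end Rigidity

/-! ### Round trips through commuting matrix pairs. -/

section Commuting

variable {n m : Type*} [Fintype n] [DecidableEq n] [Fintype m] [DecidableEq m]

theorem trace_mul_vecMulVec_star {n : Type*} [Fintype n] (A : Matrix n n ℂ) (w : n → ℂ) :
    (A * Matrix.vecMulVec w (star w)).trace = star w ⬝ᵥ (A *ᵥ w) := by
  rw [Matrix.mul_vecMulVec, Matrix.trace_vecMulVec, dotProduct_comm]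

theorem sum_eigenvalues_smul_vecMulVec {A : Matrix n n ℂ} (hA : A.IsHermitian) :
    ∑ i, (hA.eigenvalues i : ℂ) • Matrix.vecMulVec (hA.eigenvectorBasis i).ofLp
      (star (hA.eigenvectorBasis i).ofLp) = A := by
  conv_rhs => rw [eq_eigU_mul hA]
  ext i j
  rw [Matrix.sum_apply, Matrix.mul_apply]
  refine Finset.sum_congr rfl fun k _ => ?_
  rw [Matrix.mul_diagonal]
  simp [Matrix.vecMulVec_apply]
  ring

theorem sum_vecMulVec_eigenvectorBasis {A : Matrix n n ℂ} (hA : A.IsHermitian) :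
    ∑ i, Matrix.vecMulVec (hA.eigenvectorBasis i).ofLp
      (star (hA.eigenvectorBasis i).ofLp) = 1 := by
  rw [← eigU_mul_star hA]
  ext i j
  rw [Matrix.sum_apply, Matrix.mul_apply]
  refine Finset.sum_congr rfl fun k _ => ?_
  simp [Matrix.vecMulVec_apply]

theorem relOp_commute {ρ σ : Matrix n n ℂ} (h : Commute ρ σ) : Commute (relOp ρ σ) σ := by
  have h1 : Commute (matPow σ (-1 / 2)) σ := (Commute.refl σ).cfc_real _
  exact (h1.mul_left h).mul_left h1

/-- Measure in an eigenbasis of `relOp ρ' σ'` after `T`; prepare by applying `R` to the pieces into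
which the eigenprojections cut `σ'`. The eigenvalues serve as likelihood ratios. -/
theorem commute_of_interconvertibleP {ρ σ : Matrix n n ℂ} {ρ' σ' : Matrix m m ℂ}
    (h : IsDichotomy ρ σ) (h' : IsDichotomy ρ' σ') (hc : Commute ρ' σ')
    (hi : InterconvertibleP ρ σ ρ' σ') : Commute ρ σ := by
  obtain ⟨T, R, hTp, hTt, hRp, hRt, hTρ, hTσ, hRρ, hRσ⟩ := hi
  obtain ⟨L, hL, hLσ⟩ := h.exists_sld
  refine commute_of_forall_two_trace_sub_trace_le h.right.1.1 hL hLσ fun X => ?_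
  have hH := relOp_isHermitian h'.left.1.1 σ'
  set w : m → m → ℂ := fun k => (hH.eigenvectorBasis k).ofLp with hw
  set V : m → Matrix m m ℂ := fun k => Matrix.vecMulVec (w k) (star (w k)) with hV
  have hVp : ∀ k, (V k).PosSemidef := fun k => Matrix.posSemidef_vecMulVec_self_star _
  set s := matPow σ' (1 / 2) with hs
  have hsh : sᴴ = s := (matPow_isHermitian σ' _).eq
  have hss : s * s = σ' := sqrt_mul_sqrt h'.right.1
  have hV1 : ∑ k, V k = 1 := sum_vecMulVec_eigenvectorBasis hH
  have hVh : ∑ k, (hH.eigenvalues k : ℂ) • V k = relOp ρ' σ' := sum_eigenvalues_smul_vecMulVec hH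
  have hsum : ∑ k, (hH.eigenvalues k : ℂ) • R (s * V k * s) = ρ := by
    have : ∀ k, (hH.eigenvalues k : ℂ) • R (s * V k * s) =
        R (s * ((hH.eigenvalues k : ℂ) • V k) * s) := fun k => by
      rw [Matrix.mul_smul, Matrix.smul_mul, map_smul]
    rw [Finset.sum_congr rfl fun k _ => this k, ← map_sum, ← Finset.sum_mul, ← Matrix.mul_sum,
      hVh, h'.sqrt_mul_relOp_mul_sqrt, hRρ]
  have hmul : ρ' = σ' * relOp ρ' σ' := by
    have h1 : Commute s (relOp ρ' σ') := (relOp_commute hc).symm.cfc_real _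
    have h2 := h'.sqrt_mul_relOp_mul_sqrt
    rw [Matrix.mul_assoc, ← h1.eq, ← Matrix.mul_assoc, hss] at h2
    exact h2.symm
  have := two_trace_sub_trace_le (ρ := ρ) Finset.univ h.right.1 hL hLσ
    (fun k => Matrix.traceLinearMap m ℂ ℂ ∘ₗ LinearMap.mulRight ℂ (V k) ∘ₗ T)
    (fun k _ A hA => trace_mul_nonneg (hTp A hA) (hVp k))
    (fun A => by
      simp only [LinearMap.comp_apply, LinearMap.mulRight_apply, Matrix.traceLinearMap_apply]
      rw [← Matrix.trace_sum, ← Matrix.mul_sum, hV1, Matrix.mul_one, hTt])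
    (fun k => R (s * V k * s))
    (fun k _ => hRp _ (by
      have := (hVp k).mul_mul_conjTranspose_same s
      rwa [hsh] at this))
    (by rw [← map_sum, ← Finset.sum_mul, ← Matrix.mul_sum, hV1, Matrix.mul_one, hss, hRσ])
    (fun k _ => by
      simp only [LinearMap.comp_apply, LinearMap.mulRight_apply, Matrix.traceLinearMap_apply]
      rw [hRt, hTσ, Matrix.trace_mul_comm, ← Matrix.mul_assoc, hss])
    (fun k => hH.eigenvalues k)
    (fun k _ => (relOp_posSemidef h'.left.1 σ').eigenvalues_nonneg k)
    (fun k _ => by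
      simp only [LinearMap.comp_apply, LinearMap.mulRight_apply, Matrix.traceLinearMap_apply]
      rw [hTσ, hTρ, hV]
      simp only
      have hwk : relOp ρ' σ' *ᵥ w k = (hH.eigenvalues k : ℂ) • w k := by
        have := hH.mulVec_eigenvectorBasis k
        ext i
        simpa using congrFun this i
      have hρw : ρ' *ᵥ w k = (hH.eigenvalues k : ℂ) • (σ' *ᵥ w k) := by
        rw [← Matrix.mulVec_smul, ← hwk, Matrix.mulVec_mulVec, ← hmul]
      rw [trace_mul_vecMulVec_star, trace_mul_vecMulVec_star, hρw, dotProduct_smul]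
      simp)
    X
  rwa [hsum] at this

end Commuting

/-! ### Integration and restriction to cells in `L¹`. -/

section ClassicalSystem

variable {X : Type*} [MeasurableSpace X] {μ : Measure X}

/-- The integral as a linear functional on `L¹`. -/
noncomputable def integralL1 (μ : Measure X) : (X →₁[μ] ℂ) →ₗ[ℂ] ℂ where
  toFun f := ∫ x, f x ∂μ
  map_add' f g := by
    rw [← integral_add (L1.integrable_coeFn f) (L1.integrable_coeFn g)]
    exact integral_congr_ae (Lp.coeFn_add f g)
  map_smul' c f := by
    rw [RingHom.id_apply, ← integral_smul]
    exact integral_congr_ae (Lp.coeFn_smul c f)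

/-- Multiplication by the indicator function of a measurable set as a linear map on `L¹`. -/
noncomputable def restrictL1 (μ : Measure X) {E : Set X} (hE : MeasurableSet E) :
    (X →₁[μ] ℂ) →ₗ[ℂ] (X →₁[μ] ℂ) where
  toFun f := ((L1.integrable_coeFn f).indicator hE).toL1 _
  map_add' f g := by
    rw [← Integrable.toL1_add, Integrable.toL1_eq_toL1_iff]
    filter_upwards [Lp.coeFn_add f g] with x hx
    by_cases h : x ∈ E
    · simp only [Set.indicator_of_mem h, Pi.add_apply]
      exact hx
    · simp [h]
  map_smul' c f := by
    rw [RingHom.id_apply, ← Integrable.toL1_smul, Integrable.toL1_eq_toL1_iff]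
    filter_upwards [Lp.coeFn_smul c f] with x hx
    by_cases h : x ∈ E
    · simp only [Set.indicator_of_mem h]
      exact hx
    · simp [h]

theorem coeFn_restrictL1 {E : Set X} (hE : MeasurableSet E) (f : X →₁[μ] ℂ) :
    restrictL1 μ hE f =ᵐ[μ] E.indicator f :=
  Integrable.coeFn_toL1 ((L1.integrable_coeFn f).indicator hE)

/-- Finitely many cells suffice, so linearity alone carries the decomposition through `R` and no
continuity is needed. -/
theorem sum_restrictL1 {κ : X → ℕ} (hκ : Measurable κ) {N : ℕ} (hN : ∀ᵐ x ∂μ, κ x < N)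
    (f : X →₁[μ] ℂ) :
    ∑ k ∈ Finset.range N, restrictL1 μ (hκ (measurableSet_singleton k)) f = f := by
  refine Lp.ext ?_
  have h : ∀ᵐ x ∂μ, ∀ k : ℕ, restrictL1 μ (hκ (measurableSet_singleton k)) f x =
      (κ ⁻¹' {k}).indicator f x :=
    ae_all_iff.2 fun k => coeFn_restrictL1 (hκ (measurableSet_singleton k)) f
  filter_upwards [hN, h, Lp.coeFn_finsetSum (Finset.range N)
    fun k => restrictL1 μ (hκ (measurableSet_singleton k)) f] with x h1 h2 h3
  rw [h3, Finset.sum_apply, Finset.sum_congr rfl fun k _ => h2 k]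
  rw [Finset.sum_eq_single (κ x)]
  · simp
  · intro k _ hk
    exact Set.indicator_of_notMem (by simpa using hk.symm) _
  · simp [h1]

end ClassicalSystem

/-! ### Round trips through `L¹`, by discretising the density ratio. -/

section ClassicalRigidity

variable {n : Type*} [Fintype n] [DecidableEq n] {ρ σ : Matrix n n ℂ}

/-- Only the Hermitian matrix `Y + Yᴴ` contributes, and it lies below a multiple of the identity.
This controls the discretisation error. -/
theorem exists_trace_mul_le (Y : Matrix n n ℂ) :
    ∃ M : ℝ, 0 ≤ M ∧ ∀ D : Matrix n n ℂ, D.PosSemidef →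
      2 * (Y * D).trace.re ≤ M * D.trace.re := by
  obtain ⟨M, hM, hp⟩ := exists_smul_one_sub_posSemidef (Matrix.isHermitian_add_transpose_self Y)
  refine ⟨M, hM, fun D hD => ?_⟩
  have h := (Complex.nonneg_iff.1 (trace_mul_nonneg hp hD)).1
  have h2 : (Yᴴ * D).trace.re = (Y * D).trace.re := by
    have : Yᴴ * D = (D * Y)ᴴ := by rw [Matrix.conjTranspose_mul, hD.1.eq]
    rw [this, Matrix.trace_conjTranspose, Matrix.trace_mul_comm]
    simp
  rw [Matrix.sub_mul, Matrix.add_mul, Matrix.smul_mul, Matrix.one_mul, Matrix.trace_sub,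
    Matrix.trace_add, Matrix.trace_smul] at h
  simp only [Complex.sub_re, Complex.add_re, smul_eq_mul, Complex.re_ofReal_mul, h2] at h
  linarith

variable {X : Type*} [MeasurableSpace X] {μ : Measure X}

/-- A dominated pair of densities is approximated by pairs with finitely many values of the
density ratio. -/
theorem exists_partition {p q : X →₁[μ] ℂ} (hp : ∀ᵐ x ∂μ, 0 ≤ p x) (hq : ∀ᵐ x ∂μ, 0 ≤ q x)
    {C : ℝ} (hC : 0 ≤ C) (hpq : ∀ᵐ x ∂μ, p x ≤ C * q x) {ε : ℝ} (hε : 0 < ε) :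
    ∃ (κ : X → ℕ) (N : ℕ), Measurable κ ∧ (∀ᵐ x ∂μ, κ x < N) ∧
      ∀ᵐ x ∂μ, ((κ x * ε : ℝ) : ℂ) * q x ≤ p x ∧ p x ≤ ((κ x * ε : ℝ) : ℂ) * q x + ε * q x := by
  have hpm : Measurable fun x => (p x).re :=
    Complex.measurable_re.comp (Lp.stronglyMeasurable p).measurable
  have hqm : Measurable fun x => (q x).re :=
    Complex.measurable_re.comp (Lp.stronglyMeasurable q).measurable
  -- The cell index is the ratio rounded down to a multiple of `ε`, bounded because `p ≤ C q`. Where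
  -- `q = 0` division gives index `0`, and `p = 0` there too.
  refine ⟨fun x => ⌊(p x).re / (q x).re / ε⌋₊, ⌊C / ε⌋₊ + 1,
    Nat.measurable_floor.comp ((hpm.div hqm).div_const ε), ?_, ?_⟩
  · filter_upwards [hp, hq, hpq] with x h1 h2 h3
    rw [Complex.nonneg_iff] at h1 h2
    have h3 := (Complex.le_def.1 h3).1
    rw [Complex.re_ofReal_mul] at h3
    refine Nat.lt_succ_of_le (Nat.floor_le_floor ?_)
    gcongr
    exact div_le_of_le_mul₀ h2.1 hC h3
  · filter_upwards [hp, hq, hpq] with x h1 h2 h3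
    rw [Complex.nonneg_iff] at h1 h2
    have h3 := (Complex.le_def.1 h3).1
    rw [Complex.re_ofReal_mul] at h3
    set P := (p x).re
    set Q := (q x).re
    have hP : p x = (P : ℂ) := Complex.ext rfl (by simpa using h1.2.symm)
    have hQ : q x = (Q : ℂ) := Complex.ext rfl (by simpa using h2.2.symm)
    rw [hP, hQ]
    norm_cast
    rcases h2.1.eq_or_lt with h0 | h0
    · rw [← h0] at h3 ⊢
      have : P = 0 := le_antisymm (by linarith) h1.1
      simp [this]
    · have hr : 0 ≤ P / Q / ε := div_nonneg (div_nonneg h1.1 h0.le) hε.le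
      have e : P = P / Q / ε * ε * Q := by field_simp
      constructor
      · conv_rhs => rw [e]
        gcongr
        exact Nat.floor_le hr
      · conv_lhs => rw [e]
        rw [← add_mul, ← add_one_mul]
        gcongr
        exact (Nat.lt_floor_add_one _).le

theorem commute_of_interconvertibleClassical (h : IsDichotomy ρ σ) {p q : X →₁[μ] ℂ}
    (hpq : IsL1Dichotomy p q) (hi : InterconvertibleClassical ρ σ p q) : Commute ρ σ := by
  obtain ⟨T, R, hTp, hTt, hRp, hRt, hTρ, hTσ, hRρ, hRσ⟩ := hi
  obtain ⟨L, hL, hLσ⟩ := h.exists_sld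
  obtain ⟨C, hC, hCσ⟩ := h.exists_le_smul
  have hle : ∀ᵐ x ∂μ, p x ≤ C * q x := by
    have h1 := hTp _ hCσ
    rw [map_sub, map_smul, hTρ, hTσ] at h1
    filter_upwards [h1, Lp.coeFn_sub ((C : ℂ) • q) p, Lp.coeFn_smul (C : ℂ) q] with x h2 h3 h4
    rw [h3, Pi.sub_apply, h4, Pi.smul_apply, smul_eq_mul] at h2
    exact sub_nonneg.1 h2
  refine commute_of_forall_two_trace_sub_trace_le h.right.1.1 hL hLσ fun Y => ?_
  obtain ⟨M, hM, hY⟩ := exists_trace_mul_le Y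
  refine le_of_forall_pos_le_add fun δ hδ => ?_
  -- Mesh chosen so that the total error `M ε` is at most `δ`; the `+ 1` covers `M = 0`.
  set ε := δ / (M + 1) with hεd
  have hε : 0 < ε := by positivity
  have hMε : M * ε ≤ δ := by
    have : (M + 1) * ε = δ := by rw [hεd]; field_simp
    linarith
  obtain ⟨κ, N, hκ, hN, hκpq⟩ :=
    exists_partition hpq.left_nonneg hpq.right_nonneg hC hle hε
  have hE : ∀ k : ℕ, MeasurableSet (κ ⁻¹' {k}) := fun k => hκ (measurableSet_singleton k)
  set J : ℕ → (X →₁[μ] ℂ) →ₗ[ℂ] (X →₁[μ] ℂ) := fun k => restrictL1 μ (hE k) with hJ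
  have hJc : ∀ k f, J k f =ᵐ[μ] (κ ⁻¹' {k}).indicator f := fun k f => coeFn_restrictL1 (hE k) f
  have hJsum : ∀ f, ∑ k ∈ Finset.range N, J k f = f := sum_restrictL1 hκ hN
  have hJp : ∀ k f, (∀ᵐ x ∂μ, 0 ≤ f x) → ∀ᵐ x ∂μ, 0 ≤ J k f x := fun k f hf => by
    filter_upwards [hf, hJc k f] with x h1 h2
    rw [h2]
    exact Set.indicator_apply_nonneg fun _ => h1
  have hlow : ∀ k : ℕ, ∀ᵐ x ∂μ, 0 ≤ J k (p - ((k * ε : ℝ) : ℂ) • q) x := fun k => by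
    filter_upwards [hκpq, hJc k (p - ((k * ε : ℝ) : ℂ) • q),
      Lp.coeFn_sub p (((k * ε : ℝ) : ℂ) • q), Lp.coeFn_smul ((k * ε : ℝ) : ℂ) q] with x h1 h2 h3 h4
    rw [h2]
    refine Set.indicator_apply_nonneg fun hx => ?_
    rw [h3, Pi.sub_apply, h4, Pi.smul_apply, smul_eq_mul, ← (hx : κ x = k)]
    exact sub_nonneg.2 h1.1
  have hupp : ∀ k : ℕ, ∀ᵐ x ∂μ, 0 ≤ J k ((ε : ℂ) • q - (p - ((k * ε : ℝ) : ℂ) • q)) x :=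
    fun k => by
    filter_upwards [hκpq, hJc k ((ε : ℂ) • q - (p - ((k * ε : ℝ) : ℂ) • q)),
      Lp.coeFn_sub p (((k * ε : ℝ) : ℂ) • q), Lp.coeFn_smul ((k * ε : ℝ) : ℂ) q,
      Lp.coeFn_sub ((ε : ℂ) • q) (p - ((k * ε : ℝ) : ℂ) • q), Lp.coeFn_smul (ε : ℂ) q]
      with x h1 h2 h3 h4 h5 h6
    rw [h2]
    refine Set.indicator_apply_nonneg fun hx => ?_
    rw [h5, Pi.sub_apply, h3, Pi.sub_apply, h4, h6, Pi.smul_apply, Pi.smul_apply, smul_eq_mul,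
      smul_eq_mul, ← (hx : κ x = k), sub_nonneg, sub_le_iff_le_add, add_comm]
    exact h1.2
  have hmain := two_trace_sub_trace_le (ρ := ρ) (Finset.range N) h.right.1 hL hLσ
    (fun k => integralL1 μ ∘ₗ J k ∘ₗ T)
    (fun k _ A hA => integral_nonneg_of_ae (hJp k _ (hTp A hA)))
    (fun A => by
      simp only [LinearMap.comp_apply]
      rw [← map_sum, hJsum]
      exact hTt A)
    (fun k => R (J k q))
    (fun k _ => hRp _ (hJp k _ hpq.right_nonneg))
    (by rw [← map_sum, hJsum, hRσ])
    (fun k _ => by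
      simp only [LinearMap.comp_apply, hTσ]
      exact hRt _)
    (fun k => k * ε)
    (fun k _ => by positivity)
    (fun k _ => by
      have h1 : 0 ≤ integralL1 μ (J k (p - ((k * ε : ℝ) : ℂ) • q)) :=
        integral_nonneg_of_ae (hlow k)
      rw [map_sub, map_smul, map_sub, map_smul] at h1
      have h2 := (Complex.nonneg_iff.1 h1).1
      simp only [LinearMap.comp_apply, hTρ, hTσ]
      rw [smul_eq_mul, Complex.sub_re, Complex.re_ofReal_mul] at h2
      linarith)
    Y
  set ρ' := ∑ k ∈ Finset.range N, ((k * ε : ℝ) : ℂ) • R (J k q) with hρ'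
  -- Positivity of `R` on each cell squeezes `ρ - ρ'` between `0` and `ε σ`, so its trace is at most
  -- `ε`.
  have hD : ρ - ρ' = ∑ k ∈ Finset.range N, R (J k (p - ((k * ε : ℝ) : ℂ) • q)) := by
    simp only [map_sub, map_smul, Finset.sum_sub_distrib]
    rw [← map_sum, hJsum, hRρ]
  have hD2 : (ε : ℂ) • σ - (ρ - ρ') =
      ∑ k ∈ Finset.range N, R (J k ((ε : ℂ) • q - (p - ((k * ε : ℝ) : ℂ) • q))) := by
    have h1 : ∑ k ∈ Finset.range N, R (J k ((ε : ℂ) • q)) = (ε : ℂ) • σ := by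
      rw [← map_sum, hJsum, map_smul, hRσ]
    rw [hD, ← h1, ← Finset.sum_sub_distrib]
    exact Finset.sum_congr rfl fun k _ => by rw [← map_sub, ← map_sub]
  have hDp : (ρ - ρ').PosSemidef := by
    rw [hD]
    exact Matrix.posSemidef_sum _ fun k _ => hRp _ (hlow k)
  have hDt : (ρ - ρ').trace.re ≤ ε := by
    have h1 : ((ε : ℂ) • σ - (ρ - ρ')).PosSemidef := by
      rw [hD2]
      exact Matrix.posSemidef_sum _ fun k _ => hRp _ (hupp k)
    have h2 := (Complex.nonneg_iff.1 h1.trace_nonneg).1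
    rw [Matrix.trace_sub, Matrix.trace_smul, h.right.2] at h2
    simpa using h2
  have h1 := hY _ hDp
  rw [Matrix.mul_sub, Matrix.trace_sub, Complex.sub_re] at h1
  have h2 : M * (ρ - ρ').trace.re ≤ M * ε := mul_le_mul_of_nonneg_left hDt hM
  linarith

end ClassicalRigidity

/-! ### Classical Rényi divergences: homogeneity and finiteness. -/

section ClassicalDivergence

variable {ι κ : Type*} [Fintype ι] [Fintype κ]

theorem rpowSupp_nonneg {x : ℝ} (hx : 0 ≤ x) (α : ℝ) : 0 ≤ rpowSupp α x := by
  unfold rpowSupp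
  split_ifs
  · rfl
  · exact Real.rpow_nonneg hx α

theorem rpowSupp_pos {x : ℝ} (hx : 0 < x) (α : ℝ) : 0 < rpowSupp α x := by
  rw [rpowSupp, if_neg hx.ne']
  exact Real.rpow_pos_of_pos hx α

@[simp] theorem rpowSupp_zero (α : ℝ) : rpowSupp α 0 = 0 := if_pos rfl

@[simp] theorem rpowSupp_one (α : ℝ) : rpowSupp α 1 = 1 := by simp [rpowSupp]

/-- The perspective `p ^ α q ^ (1 - α)` is homogeneous of degree one. -/
theorem rpowSupp_mul_mul_rpowSupp_mul {p q c : ℝ} (hp : 0 ≤ p) (hq : 0 ≤ q) (hc : 0 ≤ c)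
    (α : ℝ) :
    rpowSupp α (p * c) * rpowSupp (1 - α) (q * c) = rpowSupp α p * rpowSupp (1 - α) q * c := by
  rcases hc.eq_or_lt with rfl | hc'
  · simp
  rcases hp.eq_or_lt with rfl | hp'
  · simp
  rcases hq.eq_or_lt with rfl | hq'
  · simp
  rw [rpowSupp, rpowSupp, rpowSupp, rpowSupp, if_neg (by positivity), if_neg (by positivity),
    if_neg hp'.ne', if_neg hq'.ne', Real.mul_rpow hp hc, Real.mul_rpow hq hc]
  have : c ^ α * c ^ (1 - α) = c := by
    rw [← Real.rpow_add hc', add_sub_cancel, Real.rpow_one]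
  calc _ = p ^ α * q ^ (1 - α) * (c ^ α * c ^ (1 - α)) := by ring
    _ = _ := by rw [this]

theorem mul_log_mul_div_mul (p q c : ℝ) :
    p * c * Real.log (p * c / (q * c)) = p * c * Real.log (p / q) := by
  rcases eq_or_ne c 0 with rfl | hc
  · simp
  · rw [mul_div_mul_right _ _ hc]

theorem mul_log_div {p q : ℝ} (h : q = 0 → p = 0) :
    p * Real.log (p / q) = p * (Real.log p - Real.log q) := by
  rcases eq_or_ne p 0 with rfl | hp
  · simp
  · rw [Real.log_div hp (mt h hp)]

theorem classicalRenyi_comp_equiv (p q : ι → ℝ) (e : κ ≃ ι) (α : ℝ) :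
    classicalRenyi (p ∘ e) (q ∘ e) α = classicalRenyi p q α := by
  unfold classicalRenyi
  simp only [Function.comp_apply]
  rw [e.sum_comp (fun i => p i * Real.log (p i / q i)),
    e.sum_comp (fun i => rpowSupp α (p i) * rpowSupp (1 - α) (q i))]

theorem IsClassicalDichotomy.comp_equiv {p q : ι → ℝ} (h : IsClassicalDichotomy p q)
    (e : κ ≃ ι) : IsClassicalDichotomy (p ∘ e) (q ∘ e) where
  left_nonneg i := h.left_nonneg _
  right_nonneg i := h.right_nonneg _
  left_sum := by rw [← h.left_sum]; exact e.sum_comp p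
  right_sum := by rw [← h.right_sum]; exact e.sum_comp q
  abs_cont i := h.abs_cont _

theorem renyiOf_ne_top_and_ne_bot {Q : ℝ} (hQ : 0 < Q) (α : ℝ) :
    renyiOf α Q ≠ ⊤ ∧ renyiOf α Q ≠ ⊥ := by
  have : renyiOf α Q = (((α - 1)⁻¹ * Real.log Q : ℝ) : EReal) := by
    rw [renyiOf, ENNReal.log_ofReal_of_pos hQ, EReal.coe_mul]
  rw [this]
  exact ⟨EReal.coe_ne_top _, EReal.coe_ne_bot _⟩

/-- Some `p i` is positive, hence so is `q i` by absolute continuity; the finite sum is then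
positive and its logarithm finite. -/
theorem IsClassicalDichotomy.classicalRenyi_finite {p q : ι → ℝ} (h : IsClassicalDichotomy p q)
    (α : ℝ) : classicalRenyi p q α ≠ ⊤ ∧ classicalRenyi p q α ≠ ⊥ := by
  unfold classicalRenyi
  split_ifs
  · exact ⟨EReal.coe_ne_top _, EReal.coe_ne_bot _⟩
  · refine renyiOf_ne_top_and_ne_bot ?_ α
    obtain ⟨i, -, hi⟩ : ∃ i ∈ Finset.univ, 0 < p i :=
      Finset.exists_lt_of_sum_lt (f := fun _ => (0 : ℝ)) (by simp [h.left_sum])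
    have hqi : 0 < q i :=
      lt_of_le_of_ne (h.right_nonneg i) fun h0 => hi.ne' (h.abs_cont i h0.symm)
    exact Finset.sum_pos' (fun j _ => mul_nonneg (rpowSupp_nonneg (h.left_nonneg j) _)
      (rpowSupp_nonneg (h.right_nonneg j) _))
      ⟨i, Finset.mem_univ i, mul_pos (rpowSupp_pos hi _) (rpowSupp_pos hqi _)⟩

end ClassicalDivergence

/-! ### Both quantum families on diagonal matrices. -/

section Diagonal

variable {n : Type*} [Fintype n] [DecidableEq n] {p q : n → ℝ}

theorem matPow_diagonal (d : n → ℝ) (α : ℝ) :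
    matPow (Matrix.diagonal fun i => (d i : ℂ)) α =
      Matrix.diagonal fun i => ((rpowSupp α (d i) : ℝ) : ℂ) :=
  cfc_diagonal _ d

theorem matLog_diagonal (d : n → ℝ) :
    matLog (Matrix.diagonal fun i => (d i : ℂ)) =
      Matrix.diagonal fun i => ((Real.log (d i) : ℝ) : ℂ) :=
  cfc_diagonal _ d

theorem trace_diagonal_ofReal_re (d : n → ℝ) :
    (Matrix.diagonal fun i => (d i : ℂ)).trace.re = ∑ i, d i := by
  simp [Matrix.trace_diagonal]

theorem rpowSupp_neg_half_mul_mul {p q : ℝ} (hq : 0 ≤ q) :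
    rpowSupp (-1 / 2) q * p * rpowSupp (-1 / 2) q = p / q := by
  rcases hq.eq_or_lt with rfl | hq'
  · simp
  have : q ^ (-1 / 2 : ℝ) * q ^ (-1 / 2 : ℝ) = q⁻¹ := by
    rw [← Real.rpow_add hq', ← Real.rpow_neg_one]
    norm_num
  rw [rpowSupp, if_neg hq'.ne', mul_right_comm, this, div_eq_mul_inv, mul_comm]

theorem rpowSupp_half_mul_mul {p q : ℝ} (hp : 0 ≤ p) :
    rpowSupp (1 / 2) p * rpowSupp (-1) q * rpowSupp (1 / 2) p = p / q := by
  rcases hp.eq_or_lt with rfl | hp'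
  · simp
  have : p ^ (1 / 2 : ℝ) * p ^ (1 / 2 : ℝ) = p := by
    rw [← Real.rpow_add hp']
    norm_num
  have h2 : rpowSupp (-1) q = q⁻¹ := by
    unfold rpowSupp
    split_ifs with h
    · simp [h]
    · exact Real.rpow_neg_one q
  rw [h2, rpowSupp, if_neg hp'.ne', mul_right_comm, this, div_eq_mul_inv]

theorem relOp_diagonal (h : IsClassicalDichotomy p q) :
    relOp (Matrix.diagonal fun i => (p i : ℂ)) (Matrix.diagonal fun i => (q i : ℂ)) =
      Matrix.diagonal fun i => ((p i / q i : ℝ) : ℂ) := by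
  rw [relOp, matPow_diagonal, Matrix.diagonal_mul_diagonal, Matrix.diagonal_mul_diagonal]
  congr 1
  ext i
  rw [← rpowSupp_neg_half_mul_mul (h.right_nonneg i)]
  push_cast
  rfl

theorem petzRenyi_diagonal (h : IsClassicalDichotomy p q) (α : ℝ) :
    petzRenyi (Matrix.diagonal fun i => (p i : ℂ)) (Matrix.diagonal fun i => (q i : ℂ)) α =
      classicalRenyi p q α := by
  unfold petzRenyi classicalRenyi
  split_ifs
  · rw [matLog_diagonal, matLog_diagonal, Matrix.diagonal_sub, Matrix.diagonal_mul_diagonal]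
    congr 1
    simp only [← Complex.ofReal_sub, ← Complex.ofReal_mul]
    rw [trace_diagonal_ofReal_re]
    exact Finset.sum_congr rfl fun i _ => (mul_log_div (h.abs_cont i)).symm
  · rw [matPow_diagonal, matPow_diagonal, Matrix.diagonal_mul_diagonal]
    simp only [← Complex.ofReal_mul]
    rw [trace_diagonal_ofReal_re]

theorem maxRenyi_diagonal (h : IsClassicalDichotomy p q) (α : ℝ) :
    maxRenyi (Matrix.diagonal fun i => (p i : ℂ)) (Matrix.diagonal fun i => (q i : ℂ)) α =
      classicalRenyi p q α := by
  unfold maxRenyi classicalRenyi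
  split_ifs
  · rw [matPow_diagonal, matPow_diagonal, Matrix.diagonal_mul_diagonal,
      Matrix.diagonal_mul_diagonal]
    simp only [← Complex.ofReal_mul]
    rw [matLog_diagonal, Matrix.diagonal_mul_diagonal]
    simp only [← Complex.ofReal_mul, rpowSupp_half_mul_mul (h.left_nonneg _)]
    rw [trace_diagonal_ofReal_re]
  · rw [relOp_diagonal h, matPow_diagonal, Matrix.diagonal_mul_diagonal]
    simp only [← Complex.ofReal_mul]
    rw [trace_diagonal_ofReal_re]
    congr 1
    refine Finset.sum_congr rfl fun i _ => ?_
    rcases (h.right_nonneg i).eq_or_lt with h0 | h0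
    · simp [← h0]
    · have h1 := rpowSupp_mul_mul_rpowSupp_mul (div_nonneg (h.left_nonneg i) h0.le) zero_le_one
        h0.le α
      rw [div_mul_cancel₀ _ h0.ne', one_mul, rpowSupp_one, mul_one] at h1
      rw [h1, mul_comm]

theorem isDensity_diagonal (hp : ∀ i, 0 ≤ p i) (h1 : ∑ i, p i = 1) :
    IsDensity (Matrix.diagonal fun i => (p i : ℂ)) := by
  refine ⟨Matrix.PosSemidef.diagonal fun i => ?_, ?_⟩
  · exact Complex.zero_le_real.2 (hp i)
  · rw [Matrix.trace_diagonal, ← Complex.ofReal_sum, h1, Complex.ofReal_one]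

theorem IsClassicalDichotomy.isDichotomy_diagonal (h : IsClassicalDichotomy p q) :
    IsDichotomy (Matrix.diagonal fun i => (p i : ℂ)) (Matrix.diagonal fun i => (q i : ℂ)) := by
  refine isDichotomy_of_eq_mul (isDensity_diagonal h.left_nonneg h.left_sum)
    (isDensity_diagonal h.right_nonneg h.right_sum)
    (W := Matrix.diagonal fun i => ((p i / q i : ℝ) : ℂ)) ?_
  rw [Matrix.diagonal_mul_diagonal]
  congr 1
  ext i
  rcases eq_or_ne (q i) 0 with h0 | h0
  · simp [h0, h.abs_cont i h0]
  · rw [← Complex.ofReal_mul, mul_div_cancel₀ _ h0]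

end Diagonal

/-! ### The simulating classical distributions. -/

section Simulation

variable {n : Type*} [Fintype n] [DecidableEq n] {ρ σ : Matrix n n ℂ}

theorem overlap_nonneg (hρ : ρ.IsHermitian) (hσ : σ.IsHermitian) (x : n × n) :
    0 ≤ overlap hρ hσ x := by
  unfold overlap
  positivity

theorem star_dotProduct_cfc_mulVec (hρ : ρ.IsHermitian) (hσ : σ.IsHermitian) (f : ℝ → ℝ) (j : n) :
    star (hσ.eigenvectorBasis j).ofLp ⬝ᵥ (cfc f ρ *ᵥ (hσ.eigenvectorBasis j).ofLp) =
      ((∑ i, f (hρ.eigenvalues i) * overlap hρ hσ (i, j) : ℝ) : ℂ) := by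
  rw [← trace_mul_vecMulVec_star, Matrix.trace_mul_comm, trace_mul_cfc hρ, Complex.ofReal_sum]
  refine Finset.sum_congr rfl fun i _ => ?_
  rw [Complex.ofReal_mul]
  congr 1
  rw [Matrix.vecMulVec_mulVec, overlap, dotProduct_smul, EuclideanSpace.inner_eq_star_dotProduct]
  set u := (hρ.eigenvectorBasis i).ofLp
  set v := (hσ.eigenvectorBasis j).ofLp
  have h1 : star v ⬝ᵥ u = star (v ⬝ᵥ star u) := by
    rw [Matrix.star_dotProduct, dotProduct_comm]
  have h2 : star u ⬝ᵥ v = v ⬝ᵥ star u := dotProduct_comm _ _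
  rw [h1, h2, Complex.ofReal_pow, ← Complex.mul_conj']
  simp

/-- The source of the Nussbaum–Szkoła distributions: suitable `f` and `g` yield normalisation, all
power traces and the relative entropy. -/
theorem trace_cfc_mul_cfc (hρ : ρ.IsHermitian) (hσ : σ.IsHermitian) (f g : ℝ → ℝ) :
    (cfc f ρ * cfc g σ).trace.re =
      ∑ x : n × n, f (hρ.eigenvalues x.1) * g (hσ.eigenvalues x.2) * overlap hρ hσ x := by
  rw [trace_mul_cfc hσ]
  simp only [star_dotProduct_cfc_mulVec hρ hσ, ← Complex.ofReal_mul, ← Complex.ofReal_sum,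
    Complex.ofReal_re]
  rw [Fintype.sum_prod_type_right]
  refine Finset.sum_congr rfl fun j _ => ?_
  rw [Finset.mul_sum]
  exact Finset.sum_congr rfl fun i _ => by ring

theorem cfc_one_eq (hσ : σ.IsHermitian) : cfc (fun _ => (1 : ℝ)) σ = 1 :=
  cfc_const_one ℝ σ (ha := hσ)

theorem cfc_id_eq (hσ : σ.IsHermitian) : cfc (fun x : ℝ => x) σ = σ :=
  cfc_id' ℝ σ (ha := hσ)

theorem IsDichotomy.nussbaumSzkola (h : IsDichotomy ρ σ) (hρ : ρ.IsHermitian)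
    (hσ : σ.IsHermitian) : IsClassicalDichotomy (nsLeft hρ hσ) (nsRight hρ hσ) where
  left_nonneg x := mul_nonneg (h.left.1.eigenvalues_nonneg _) (overlap_nonneg hρ hσ x)
  right_nonneg x := mul_nonneg (h.right.1.eigenvalues_nonneg _) (overlap_nonneg hρ hσ x)
  left_sum := by
    have := trace_cfc_mul_cfc hρ hσ (fun x => x) (fun _ => 1)
    rw [cfc_one_eq hσ, cfc_id_eq hρ, Matrix.mul_one, h.left.2] at this
    simpa [nsLeft] using this.symm
  right_sum := by
    have := trace_cfc_mul_cfc hρ hσ (fun _ => 1) (fun x => x)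
    rw [cfc_one_eq hρ, cfc_id_eq hσ, Matrix.one_mul, h.right.2] at this
    simpa [nsRight] using this.symm
  abs_cont := by
    rintro ⟨i, j⟩ h0
    rcases mul_eq_zero.1 h0 with h1 | h1
    -- If `q_j = 0`, then `v_j` lies in the kernel of `σ`, hence in that of `ρ`. So `⟨v_j, ρ v_j⟩`,
    -- a sum over `i` of the nonnegative `P (i, j)`, vanishes termwise.
    · obtain ⟨W, hW⟩ := h.exists_eq_mul
      have hρW : ρ = Wᴴ * σ := by
        rw [← hρ.eq, hW, Matrix.conjTranspose_mul, hσ.eq]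
      have hσv : σ *ᵥ (hσ.eigenvectorBasis j).ofLp = 0 := by
        have := hσ.mulVec_eigenvectorBasis j
        rw [h1, zero_smul] at this
        exact this
      have hv := star_dotProduct_cfc_mulVec hρ hσ (fun x => x) j
      rw [cfc_id_eq hρ] at hv
      have hρv : ρ *ᵥ (hσ.eigenvectorBasis j).ofLp = 0 := by
        rw [hρW, ← Matrix.mulVec_mulVec, hσv, Matrix.mulVec_zero]
      rw [hρv, dotProduct_zero, eq_comm, Complex.ofReal_eq_zero] at hv
      exact (Finset.sum_eq_zero_iff_of_nonneg fun k _ =>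
        mul_nonneg (h.left.1.eigenvalues_nonneg _) (overlap_nonneg hρ hσ (k, j))).1 hv i
        (Finset.mem_univ i)
    · rw [nsLeft, h1, mul_zero]

theorem IsDichotomy.petzRenyi_eq (h : IsDichotomy ρ σ) (hρ : ρ.IsHermitian)
    (hσ : σ.IsHermitian) (α : ℝ) :
    petzRenyi ρ σ α = classicalRenyi (nsLeft hρ hσ) (nsRight hρ hσ) α := by
  unfold petzRenyi classicalRenyi
  split_ifs
  · congr 1
    have h1 := trace_cfc_mul_cfc hρ hσ (fun x => x * Real.log x) (fun _ => 1)
    have h2 := trace_cfc_mul_cfc hρ hσ (fun x => x) Real.log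
    rw [cfc_one_eq hσ, Matrix.mul_one, cfc_mul (fun x : ℝ => x) Real.log ρ
      (continuousOn_spectrum _ _) (continuousOn_spectrum _ _), cfc_id_eq hρ] at h1
    rw [cfc_id_eq hρ] at h2
    rw [Matrix.mul_sub, Matrix.trace_sub, Complex.sub_re, matLog, matLog, h1, h2,
      ← Finset.sum_sub_distrib]
    refine Finset.sum_congr rfl fun x _ => ?_
    have hac := (h.nussbaumSzkola hρ hσ).abs_cont x
    simp only [nsLeft, nsRight] at hac ⊢
    rw [mul_log_mul_div_mul]
    rcases eq_or_ne (overlap hρ hσ x) 0 with h0 | h0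
    · simp [h0]
    · have : hσ.eigenvalues x.2 = 0 → hρ.eigenvalues x.1 = 0 := fun hq =>
        (mul_eq_zero.1 (hac (by rw [hq, zero_mul]))).resolve_right h0
      have h3 := mul_log_div this
      linear_combination (-overlap hρ hσ x) * h3
  · congr 1
    rw [matPow, matPow, trace_cfc_mul_cfc hρ hσ]
    exact Finset.sum_congr rfl fun x _ => (rpowSupp_mul_mul_rpowSupp_mul
      (h.left.1.eigenvalues_nonneg _) (h.right.1.eigenvalues_nonneg _)
      (overlap_nonneg hρ hσ x) α).symm

theorem spectralRight_nonneg (hρ : ρ.IsHermitian) (hσ : σ.PosSemidef) (i : n) :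
    0 ≤ spectralRight hρ σ i :=
  hσ.re_dotProduct_nonneg _

theorem trace_mul_cfc_relOp (hρ : ρ.IsHermitian) (f : ℝ → ℝ) :
    (σ * cfc f (relOp ρ σ)).trace.re =
      ∑ i, f ((relOp_isHermitian hρ σ).eigenvalues i) * spectralRight hρ σ i := by
  rw [trace_mul_cfc (relOp_isHermitian hρ σ), Complex.re_sum]
  exact Finset.sum_congr rfl fun i _ => Complex.re_ofReal_mul _ _

theorem IsDichotomy.spectral (h : IsDichotomy ρ σ) (hρ : ρ.IsHermitian) :
    IsClassicalDichotomy (spectralLeft hρ σ) (spectralRight hρ σ) where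
  left_nonneg i := mul_nonneg ((relOp_posSemidef h.left.1 σ).eigenvalues_nonneg i)
    (spectralRight_nonneg hρ h.right.1 i)
  right_nonneg i := spectralRight_nonneg hρ h.right.1 i
  left_sum := by
    have h1 := trace_mul_cfc_relOp (σ := σ) hρ fun x => x
    rw [cfc_id_eq (relOp_isHermitian hρ σ)] at h1
    have h2 : (σ * relOp ρ σ).trace = 1 := by
      have h3 := congrArg Matrix.trace h.sqrt_mul_relOp_mul_sqrt
      rwa [Matrix.trace_mul_comm, ← Matrix.mul_assoc, sqrt_mul_sqrt h.right.1, h.left.2] at h3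
    rw [h2] at h1
    exact h1.symm
  right_sum := by
    have h1 := trace_mul_cfc_relOp (σ := σ) hρ fun _ => 1
    rw [cfc_one_eq (relOp_isHermitian hρ σ), Matrix.mul_one, h.right.2] at h1
    simpa using h1.symm
  abs_cont i h0 := by rw [spectralLeft, h0, mul_zero]

/-- For `B = σ ^ (-1/2) ρ ^ (1/2)` the two operators under the logarithm are `Bᴴ B` and `B Bᴴ`, and
functional calculus moves across `B`; cyclicity of the trace does the rest. -/
theorem IsDichotomy.trace_mul_matLog (h : IsDichotomy ρ σ) :
    (ρ * matLog (matPow ρ (1 / 2) * matPow σ (-1) * matPow ρ (1 / 2))).trace =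
      (σ * cfc (fun x => Real.log x * x) (relOp ρ σ)).trace := by
  set r := matPow ρ (1 / 2) with hr
  set s := matPow σ (1 / 2) with hs
  set B := matPow σ (-1 / 2) * r with hB
  have hrr : r * r = ρ := sqrt_mul_sqrt h.left.1
  have hss : s * s = σ := sqrt_mul_sqrt h.right.1
  have hrh : rᴴ = r := (matPow_isHermitian ρ _).eq
  have hsh : sᴴ = s := (matPow_isHermitian σ _).eq
  have hBh : Bᴴ = r * matPow σ (-1 / 2) := by
    rw [hB, Matrix.conjTranspose_mul, hrh, (matPow_isHermitian σ _).eq]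
  have hBB : Bᴴ * B = r * matPow σ (-1) * r := by
    rw [hBh, hB, ← matPow_mul_matPow h.right.1 (show (-1 / 2 : ℝ) + -1 / 2 = -1 by norm_num)]
    simp only [Matrix.mul_assoc]
  have hBB' : B * Bᴴ = relOp ρ σ := by
    rw [hBh, hB, relOp, ← hrr]
    simp only [Matrix.mul_assoc]
  -- Writing `r = ρ ρ ^ (-1/2)` lets the support projection of `σ` be absorbed by `ρ`.
  have hsB : s * B = r := by
    have h1 : r = ρ * matPow ρ (-1 / 2) := by
      have := matPow_mul_matPow h.left.1 (show (1 : ℝ) + -1 / 2 = 1 / 2 by norm_num)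
      rwa [matPow_one h.left.1, eq_comm] at this
    rw [hB, ← Matrix.mul_assoc, matPow_mul_matPow h.right.1 (c := 0) (by norm_num), h1,
      ← Matrix.mul_assoc, h.matPow_zero_mul]
  have hBs : Bᴴ * s = r := by
    have := congrArg Matrix.conjTranspose hsB
    rwa [Matrix.conjTranspose_mul, hsh, hrh] at this
  have hH : (relOp ρ σ).IsHermitian := relOp_isHermitian h.left.1.1 σ
  rw [← hBB, matLog, cfc_mul Real.log (fun x => x) (relOp ρ σ) (continuousOn_spectrum _ _)
    (continuousOn_spectrum _ _), cfc_id_eq hH]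
  set F := cfc Real.log (Bᴴ * B)
  have hF : B * F = cfc Real.log (relOp ρ σ) * B := by
    rw [mul_cfc_conjTranspose_mul_self, hBB']
  calc (ρ * F).trace = (r * (r * F)).trace := by rw [← hrr, Matrix.mul_assoc]
    _ = (r * F * r).trace := by rw [Matrix.trace_mul_comm]
    _ = (s * (B * F) * (Bᴴ * s)).trace := by
        rw [hBs, ← Matrix.mul_assoc, hsB]
    _ = (s * (cfc Real.log (relOp ρ σ) * (B * Bᴴ) * s)).trace := by
        rw [hF]; simp only [Matrix.mul_assoc]
    _ = (cfc Real.log (relOp ρ σ) * (B * Bᴴ) * (s * s)).trace := by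
        rw [Matrix.trace_mul_comm]; simp only [Matrix.mul_assoc]
    _ = _ := by rw [hBB', hss, Matrix.trace_mul_comm]

theorem IsDichotomy.maxRenyi_eq (h : IsDichotomy ρ σ) (hρ : ρ.IsHermitian) (α : ℝ) :
    maxRenyi ρ σ α = classicalRenyi (spectralLeft hρ σ) (spectralRight hρ σ) α := by
  unfold maxRenyi classicalRenyi
  split_ifs
  · rw [h.trace_mul_matLog, trace_mul_cfc_relOp hρ]
    congr 1
    refine Finset.sum_congr rfl fun i _ => ?_
    have h1 := mul_log_mul_div_mul ((relOp_isHermitian hρ σ).eigenvalues i) 1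
      (spectralRight hρ σ i)
    rw [one_mul, div_one] at h1
    rw [spectralLeft, h1]
    ring
  · congr 1
    rw [matPow, trace_mul_cfc_relOp hρ]
    refine Finset.sum_congr rfl fun i _ => ?_
    -- Homogeneity applied to the pair `(t_i, 1)` scaled by the weight of `σ`.
    have h1 := rpowSupp_mul_mul_rpowSupp_mul ((relOp_posSemidef h.left.1 σ).eigenvalues_nonneg i)
      zero_le_one (spectralRight_nonneg hρ h.right.1 i) α
    rw [one_mul, rpowSupp_one, mul_one] at h1
    exact h1.symm

end Simulation

/-! ### From simulation and rigidity to insufficiency. -/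

section Insufficiency

/-- The case of a one-dimensional ancilla, with indices matched by taking submatrices. -/
theorem IsCPMap.isPositiveMap {n m : Type*} [Fintype n] [Fintype m]
    {T : Matrix n n ℂ →ₗ[ℂ] Matrix m m ℂ} (hT : IsCPMap T) : IsPositiveMap T := fun _ hA =>
  (hT 1 _ (hA.submatrix (Prod.fst : n × Fin 1 → n))).submatrix fun x => (x, 0)

theorem InterconvertibleCP.interconvertibleP {n m : Type*} [Fintype n] [Fintype m]
    {ρ₁ σ₁ : Matrix n n ℂ} {ρ₂ σ₂ : Matrix m m ℂ} (h : InterconvertibleCP ρ₁ σ₁ ρ₂ σ₂) :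
    InterconvertibleP ρ₁ σ₁ ρ₂ σ₂ := by
  obtain ⟨T, R, hT, hTt, hR, hRt, h⟩ := h
  exact ⟨T, R, hT.isPositiveMap, hTt, hR.isPositiveMap, hRt, h⟩

theorem not_interconvertibleP_diagonal {n m : Type*} [Fintype n] [DecidableEq n] [Fintype m]
    [DecidableEq m] {ρ σ : Matrix n n ℂ} (h : IsDichotomy ρ σ) (hc : ¬ Commute ρ σ)
    {p q : m → ℝ} (hpq : IsClassicalDichotomy p q) :
    ¬ InterconvertibleP ρ σ (Matrix.diagonal fun i => (p i : ℂ))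
      (Matrix.diagonal fun i => (q i : ℂ)) := fun hi =>
  hc (commute_of_interconvertibleP h hpq.isDichotomy_diagonal (Matrix.commute_diagonal _ _) hi)

theorem failsAtEveryNoncommuting_petzRenyi :
    FailsAtEveryNoncommuting (fun _ => petzRenyi) := by
  intro n ρ σ h hc
  have hρ := h.left.1.1
  have hσ := h.right.1.1
  -- The distributions live on pairs of indices and are relabelled by `Fin (n * n)`.
  have hpq := (h.nussbaumSzkola hρ hσ).comp_equiv finProdFinEquiv.symm
  refine ⟨n * n, _, _, hpq, fun α _ => ⟨?_, petzRenyi_diagonal hpq α,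
    hpq.classicalRenyi_finite α⟩, not_interconvertibleP_diagonal h hc hpq⟩
  rw [classicalRenyi_comp_equiv]
  exact h.petzRenyi_eq hρ hσ α

theorem failsAtEveryNoncommuting_maxRenyi :
    FailsAtEveryNoncommuting (fun _ => maxRenyi) := by
  intro n ρ σ h hc
  have hpq := h.spectral h.left.1.1
  exact ⟨n, _, _, hpq, fun α _ => ⟨h.maxRenyi_eq _ α, maxRenyi_diagonal hpq α,
    hpq.classicalRenyi_finite α⟩, not_interconvertibleP_diagonal h hc hpq⟩

theorem exists_isDichotomy_not_commute :
    ∃ ρ σ : Matrix (Fin 2) (Fin 2) ℂ, IsDichotomy ρ σ ∧ ¬ Commute ρ σ := by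
  set d : Fin 2 → ℝ := ![1 / 3, 2 / 3] with hd
  -- A pure state with nonzero off-diagonal entries cannot commute with a diagonal matrix having
  -- distinct entries; invertibility of the latter gives the support condition.
  set ρ : Matrix (Fin 2) (Fin 2) ℂ := (1 / 2 : ℂ) • Matrix.vecMulVec 1 (star 1) with hρ
  refine ⟨ρ, Matrix.diagonal fun i => (d i : ℂ),
    isDichotomy_of_eq_mul ⟨?_, ?_⟩ (isDensity_diagonal (fun i => ?_) ?_)
      (W := Matrix.diagonal (fun i => ((d i)⁻¹ : ℂ)) * ρ) ?_, fun hc => ?_⟩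
  · exact (Matrix.posSemidef_vecMulVec_self_star 1).smul (by norm_num [Complex.nonneg_iff])
  · rw [hρ, Matrix.trace_smul, Matrix.trace_fin_two]
    norm_num [Matrix.vecMulVec_apply]
  · fin_cases i <;> norm_num [hd]
  · norm_num [hd, Fin.sum_univ_two]
  · rw [← Matrix.mul_assoc, Matrix.diagonal_mul_diagonal]
    have : (fun i => (d i : ℂ) * (d i : ℂ)⁻¹) = fun _ => 1 := by
      ext i
      fin_cases i <;> norm_num [hd]
    rw [this, Matrix.diagonal_one, Matrix.one_mul]
  · have := congrFun (congrFun hc.eq 0) 1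
    rw [Matrix.mul_diagonal, Matrix.diagonal_mul] at this
    norm_num [hρ, hd, Matrix.vecMulVec_apply] at this

/-- It is the implication from equal divergences to interconvertibility that fails. Any notion
stronger than conversion by positive maps is covered, channels in particular. -/
theorem not_isSufficient_of_failsAtEveryNoncommuting
    {Conv : ∀ n m : ℕ, Matrix (Fin n) (Fin n) ℂ → Matrix (Fin n) (Fin n) ℂ →
      Matrix (Fin m) (Fin m) ℂ → Matrix (Fin m) (Fin m) ℂ → Prop}
    (hConv : ∀ n m ρ₁ σ₁ ρ₂ σ₂, Conv n m ρ₁ σ₁ ρ₂ σ₂ → InterconvertibleP ρ₁ σ₁ ρ₂ σ₂)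
    {D : ∀ n : ℕ, Matrix (Fin n) (Fin n) ℂ → Matrix (Fin n) (Fin n) ℂ → ℝ → EReal}
    (hD : FailsAtEveryNoncommuting D) {Λ : Set ℝ} (hΛ : Λ ⊆ Set.Ici 0)
    (hab : ∃ a b : ℝ, a < b ∧ Set.Ioo a b ⊆ Λ) : ¬ IsSufficient Conv D Λ := by
  intro hs
  obtain ⟨a, b, hab, hI⟩ := hab
  obtain ⟨ρ, σ, h, hc⟩ := exists_isDichotomy_not_commute
  obtain ⟨m, p, q, hpq, hα, hn⟩ := hD 2 ρ σ h hc
  refine hn (hConv _ _ _ _ _ _ ((hs 2 m ρ σ _ _ h hpq.isDichotomy_diagonal a b hab hI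
    fun α hαI => ?_).2 fun α hαI => ?_))
  · obtain ⟨h1, h2, h3⟩ := hα α (hΛ (hI hαI))
    rw [h1, h2]
    exact ⟨h3, h3⟩
  · obtain ⟨h1, h2, -⟩ := hα α (hΛ (hI hαI))
    rw [h1, h2]

end Insufficiency

end QDichotomy

theorem corollary3p9 :
    -- neither family is sufficient, for positive maps and for channels
    (∀ Λ : Set ℝ, Λ ⊆ Set.Ici 0 → (∃ a b : ℝ, a < b ∧ Set.Ioo a b ⊆ Λ) →
      ¬ IsSufficient (fun _ _ => InterconvertibleP) (fun _ => petzRenyi) Λ ∧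
      ¬ IsSufficient (fun _ _ => InterconvertibleP) (fun _ => maxRenyi) Λ ∧
      ¬ IsSufficient (fun _ _ => InterconvertibleCP) (fun _ => petzRenyi) Λ ∧
      ¬ IsSufficient (fun _ _ => InterconvertibleCP) (fun _ => maxRenyi) Λ) ∧
    FailsAtEveryNoncommuting (fun _ => petzRenyi) ∧
    FailsAtEveryNoncommuting (fun _ => maxRenyi) ∧
    -- both families are classically simulated
    (∀ (n : ℕ) (ρ σ : Matrix (Fin n) (Fin n) ℂ) (hρ : ρ.IsHermitian) (hσ : σ.IsHermitian),
      IsDichotomy ρ σ →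
      IsClassicalDichotomy (nsLeft hρ hσ) (nsRight hρ hσ) ∧
      (∀ α : ℝ, 0 ≤ α → petzRenyi ρ σ α = classicalRenyi (nsLeft hρ hσ) (nsRight hρ hσ) α) ∧
      IsClassicalDichotomy (spectralLeft hρ σ) (spectralRight hρ σ) ∧
      (∀ α : ℝ, 0 ≤ α →
        maxRenyi ρ σ α = classicalRenyi (spectralLeft hρ σ) (spectralRight hρ σ) α)) ∧
    -- non-commuting dichotomies are never interconvertible with classical ones
    (∀ (n : ℕ) (ρ σ : Matrix (Fin n) (Fin n) ℂ), IsDichotomy ρ σ → ¬ Commute ρ σ →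
      (∀ (m : ℕ) (ρ' σ' : Matrix (Fin m) (Fin m) ℂ), IsDichotomy ρ' σ' → Commute ρ' σ' →
        ¬ InterconvertibleP ρ σ ρ' σ') ∧
      (∀ (X : Type*) [MeasurableSpace X] (μ : Measure X) [SigmaFinite μ] (p q : X →₁[μ] ℂ),
        IsL1Dichotomy p q → ¬ InterconvertibleClassical ρ σ p q)) := by
  refine ⟨fun Λ hΛ hab => ⟨?_, ?_, ?_, ?_⟩, failsAtEveryNoncommuting_petzRenyi,
    failsAtEveryNoncommuting_maxRenyi, fun n ρ σ hρ hσ h => ⟨h.nussbaumSzkola hρ hσ,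
      fun α _ => h.petzRenyi_eq hρ hσ α, h.spectral hρ, fun α _ => h.maxRenyi_eq hρ α⟩,
    fun n ρ σ h hc => ⟨fun m ρ' σ' h' hc' hi => hc (commute_of_interconvertibleP h h' hc' hi),
      fun X _ μ _ p q hpq hi => hc (commute_of_interconvertibleClassical h hpq hi)⟩⟩
  · exact not_isSufficient_of_failsAtEveryNoncommuting (fun _ _ _ _ _ _ hi => hi)
      failsAtEveryNoncommuting_petzRenyi hΛ hab
  · exact not_isSufficient_of_failsAtEveryNoncommuting (fun _ _ _ _ _ _ hi => hi)
      failsAtEveryNoncommuting_maxRenyi hΛ hab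
  · exact not_isSufficient_of_failsAtEveryNoncommuting
      (fun _ _ _ _ _ _ hi => hi.interconvertibleP) failsAtEveryNoncommuting_petzRenyi hΛ hab
  · exact not_isSufficient_of_failsAtEveryNoncommuting
      (fun _ _ _ _ _ _ hi => hi.interconvertibleP) failsAtEveryNoncommuting_maxRenyi hΛ hab
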